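/- Let $n\ge 1$ be an integer and let $a,b>-1$ be real. For $k\in\mathbb C$ with $\operatorname{Re}k>-b-1$ define the moments of the Jacobi unitary ensemble by $$M(k,n)=\frac1C\int_{[0,1]^n}\Bigl(\sum_{j=1}^n x_j^k\Bigr)\prod_{j=1}^n x_j^{b}(1-x_j)^{a}\prod_{1\le i<j\le n}|x_j-x_i|^2\,dx_1\cdots dx_n,$$ $$C=\int_{[0,1]^n}\prod_{j=1}^n x_j^{b}(1-x_j)^{a}\prod_{1\le i<j\le n}|x_j-x_i|^2\,dx_1\cdots dx_n;$$ these integrals converge absolutely and $C>0$. Write $(x)_{(y)}=\Gamma(x+y)/\Gamma(x)$. Let $\binom{k}{j}=\frac{\Gamma(k+1)}{\Gamma(k-j+1)\Gamma(j+1)}$ for integer $j$, read as $(-1)^j\binom{m+j-1}{m-1}$ for $k=-m$ a negative integer and $j\ge0$, and as $0$ for $j<0$. Put $$U^{n,a,b}_{k,j}=\frac{(a+b+2n-2j+k+1)\,(a+b+n)_{(k-j+1)}\,(a+n-j+1)_{(j)}\,(b+n)_{(k-j+1)}}{(a+b+2n-j)_{(k+2)}\,(a+b+2n-j+1)_{(k)}\,(n+1)_{(-j)}}.$$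 1. For every complex $k\neq0$ with $\operatorname{Re}k>-b-1$, $$M(k,n)-M(k+1,n)=\frac1k\sum_{j=0}^{n}\binom kj\binom k{j-1}U^{n,a,b}_{k,j}.$$ The right-hand side is evaluated literally if $a+b+n\ne0$ and $a+b+k+1\ne0$. In all cases, including the two exceptional ones, where Gamma functions have poles that cancel, it equals the limit of the same expression with $a$ replaced by $a'$, as $a'\to a$, $a'\ne a$. 2. If $k$ is a positive integer and $a+b+n\neq 0$, the sum in 1 may be restricted to $0\le j\le\min(n,k)$. 3. The first moment is $$M(1,n)=\frac{n(b+n)}{a+b+2n}.$$ 4. For every integer $k\ge1$, $$M(k,n)=M(1,n)-\sum_{j=1}^{k-1}\frac1j\sum_{i=1}^{\min(j,n)}\binom ji\binom j{i-1}U^{n,a,b}_{j,i},$$ literally if $a+b+n\neq0$ (which can fail only for $n=1$, $a+b=-1$), and in all cases with the coefficients $U^{n,a,b}_{j,i}$ on the right replaced by $U^{n,a',b}_{j,i}$ and the limit $a'\to a$, $a'\neq a$, taken. -/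

import Mathlib

open MeasureTheory Filter Topology

noncomputable section

namespace JUE

/-- The binomial coefficient `binom(z, j)` with complex upper entry and integer lower entry:
`z (z - 1) ⋯ (z - j + 1) / j!` for `j ≥ 0`, and `0` for `j < 0`. The two theorems below show that
it is `Γ(z+1) / (Γ(z-j+1) Γ(j+1))` when `z` is not a negative integer, and the limiting form
`(-1)^j binom(m+j-1, m-1)` at `z = -m`. -/
def binom (z : ℂ) (j : ℤ) : ℂ :=
  if 0 ≤ j then Ring.choose z j.toNat else 0

/-- The Pochhammer symbol `(x)_{(y)} = Γ(x + y) / Γ(x)`. -/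
def poch (x y : ℂ) : ℂ :=
  Complex.Gamma (x + y) / Complex.Gamma x

/-- The cube `[0,1]^n`. -/
def cube (n : ℕ) : Set (Fin n → ℝ) :=
  Set.pi Set.univ fun _ => Set.Icc (0 : ℝ) 1

/-- The one-variable weight `x^b (1-x)^a`. -/
def weight (a b x : ℝ) : ℝ :=
  x ^ b * (1 - x) ^ a

/-- The unnormalised joint eigenvalue density `∏_j w(x_j) ∏_{i<j} |x_j - x_i|²`. -/
def jointWeight (a b : ℝ) (n : ℕ) (x : Fin n → ℝ) : ℝ :=
  (∏ j, weight a b (x j)) * ∏ i, ∏ j ∈ Finset.Ioi i, |x j - x i| ^ 2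

/-- The normalisation constant of the joint density. -/
def normConst (a b : ℝ) (n : ℕ) : ℝ :=
  ∫ x in cube n, jointWeight a b n x

/-- The integrand `(∑_j x_j^k) ∏_j w(x_j) ∏_{i<j} |x_j - x_i|²`. -/
def momentIntegrand (a b : ℝ) (k : ℂ) (n : ℕ) (x : Fin n → ℝ) : ℂ :=
  (∑ j, (x j : ℂ) ^ k) * (jointWeight a b n x : ℂ)

/-- The moment `M(k, n)`, the expectation of `∑_j x_j^k`. -/
def moment (a b : ℝ) (k : ℂ) (n : ℕ) : ℂ :=
  1 / (normConst a b n : ℂ) * ∫ x in cube n, momentIntegrand a b k n x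

/-- The difference `M(k, n) - M(k + 1, n)`. -/
def momentDiff (a b : ℝ) (k : ℂ) (n : ℕ) : ℂ :=
  moment a b k n - moment a b (k + 1) n

/-- The coefficient `U_{k,j}^{n,a,b}`. -/
def coeffU (n : ℕ) (a b : ℝ) (k : ℂ) (j : ℕ) : ℂ :=
  ((a + b + 2 * n - 2 * j + k + 1) * poch (a + b + n) (k - j + 1) * poch (a + n - j + 1) j *
      poch (b + n) (k - j + 1)) /
    (poch (a + b + 2 * n - j) (k + 2) * poch (a + b + 2 * n - j + 1) k * poch (n + 1) (-j))

theorem binom_eq_Gamma (z : ℂ) (hz : ∀ m : ℕ, z ≠ -(m + 1)) (j : ℤ) :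
    binom z j =
      Complex.Gamma (z + 1) / (Complex.Gamma (z - j + 1) * Complex.Gamma (j + 1)) := by
  unfold binom
  split_ifs with hj
  · lift j to ℕ using hj
    simp only [Int.toNat_natCast, Int.cast_natCast]
    induction j with
    | zero =>
      have h : Complex.Gamma (z + 1) ≠ 0 := by
        refine Complex.Gamma_ne_zero fun m hm => hz m ?_
        linear_combination hm
      simp [h]
    | succ j ih =>
      have hrec : Ring.choose z (j + 1) = Ring.choose z j * (z - j) / (j + 1) := by
        rw [Ring.choose_eq_smul, Ring.choose_eq_smul, descPochhammer_succ_right]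
        have h1 : ((j.factorial : ℕ) : ℂ) ≠ 0 := by exact_mod_cast j.factorial_ne_zero
        have h2 : (j : ℂ) + 1 ≠ 0 := by exact_mod_cast j.succ_ne_zero
        simp [Nat.factorial_succ, Polynomial.smeval_mul, Polynomial.smeval_sub,
          Polynomial.smeval_natCast]
        field_simp
      have h2 : (j : ℂ) + 1 ≠ 0 := by exact_mod_cast j.succ_ne_zero
      rw [hrec, ih]
      push_cast
      rw [Complex.Gamma_add_one _ h2]
      by_cases h : z - j = 0
      · have h0 : z - (j + 1) + 1 = 0 := by linear_combination h
        rw [h, h0, Complex.Gamma_zero]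
        simp
      · rw [Complex.Gamma_add_one _ h, show z - (j + 1) + 1 = z - j by ring]
        by_cases h3 : Complex.Gamma (z - j) = 0
        · simp [h3]
        · by_cases h4 : Complex.Gamma (j + 1) = 0
          · simp [h4]
          · field_simp
  · obtain ⟨m, hm⟩ : ∃ m : ℕ, j = -(m : ℤ) - 1 := ⟨(-j - 1).toNat, by omega⟩
    have : ((j : ℂ) + 1) = -(m : ℂ) := by rw [hm]; push_cast; ring
    rw [this, Complex.Gamma_neg_nat_eq_zero]
    simp

theorem binom_neg (m j : ℕ) (hm : 1 ≤ m) :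
    binom (-m) j = (-1) ^ j * ((m + j - 1).choose (m - 1) : ℂ) := by
  obtain ⟨m, rfl⟩ := Nat.exists_eq_add_of_le' hm
  have h : ((m + 1 : ℕ) : ℂ) + j - 1 = ((m + j : ℕ) : ℂ) := by push_cast; ring
  simp only [binom, Int.natCast_nonneg, if_true, Int.toNat_natCast]
  rw [Ring.choose_neg, h, Ring.choose_natCast, show m + 1 + j - 1 = m + j by omega,
    Nat.add_sub_cancel, Nat.choose_symm_add]
  rw [Int.negOnePow_def]
  simp [Units.smul_def]

end JUE

end

noncomputable section

namespace JUE

open Polynomial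

/-! Put s = b + 1, t = a + 1, w = x^(s-1) (1-x)^(t-1), and let p_i be the monic Jacobi polynomials
for w with squared norms h_i. Expanding both Vandermonde factors in the p_i and using orthogonality
gives the one-point density, so M(k, n) = ∑_{i<n} ∫ x^k p_i² w / h_i (`moment_eq`).

For the difference, integrating the derivative of x^(s+k) (1-x)^t p_i² gives k ∫ x^k (1-x) p_i² w =
-∫ x^k (D p_i) p_i w, where D = `skewOp`. D is skew-symmetric for w and raises degree by at most
one, so D p_i involves only p_{i+1} and p_{i-1}. The sum over i telescopes to a multiple of ∫ x^k
p_{n+1} p_n w, for ensemble size n + 1 (`sum_betaL_one_sub_X_mul_sq`).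

This integral is expanded in the Jacobi polynomials of the weight x^k w. By Rodrigues' formula the
connection coefficients are single products containing k (k-1) ⋯ (k-m+1), hence the two binomials
(`betaL_jacobi_mul_jacobi_shift`, `coeffV_eq`). For complex k the pairing is only bilinear, but
nonvanishing norms suffice.

The resulting coefficient `coeffV` has no poles and is continuous in a. It equals `coeffU` off the
two exceptional values, which yields both the literal and the limiting formulas. -/

/-! ### Rising and falling factorials. -/

/-- The rising factorial `x (x + 1) ⋯ (x + n - 1)`. -/
def rise (x : ℂ) (n : ℕ) : ℂ := ∏ i ∈ Finset.range n, (x + i)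

/-- The falling factorial `x (x - 1) ⋯ (x - n + 1)`. -/
def fall (x : ℂ) (n : ℕ) : ℂ := ∏ i ∈ Finset.range n, (x - i)

theorem rise_zero (x : ℂ) : rise x 0 = 1 := by simp [rise]

theorem fall_zero (x : ℂ) : fall x 0 = 1 := by simp [fall]

theorem rise_succ (x : ℂ) (n : ℕ) : rise x (n + 1) = rise x n * (x + n) := by
  simp [rise, Finset.prod_range_succ]

theorem fall_succ (x : ℂ) (n : ℕ) : fall x (n + 1) = fall x n * (x - n) := by
  simp [fall, Finset.prod_range_succ]

theorem rise_succ_left (x : ℂ) (n : ℕ) : rise x (n + 1) = x * rise (x + 1) n := by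
  rw [rise, Finset.prod_range_succ', mul_comm]
  simp [rise, add_comm, add_left_comm]

theorem fall_succ_left (x : ℂ) (n : ℕ) : fall x (n + 1) = x * fall (x - 1) n := by
  rw [fall, Finset.prod_range_succ', mul_comm]
  simp [fall, sub_sub, add_comm]

theorem rise_add (x : ℂ) (m n : ℕ) : rise x (m + n) = rise x m * rise (x + m) n := by
  simp [rise, Finset.prod_range_add, add_assoc]

theorem rise_ne_zero {x : ℂ} {n : ℕ} (h : ∀ i < n, x + i ≠ 0) : rise x n ≠ 0 :=
  Finset.prod_ne_zero_iff.2 fun i hi => h i (Finset.mem_range.1 hi)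

theorem rise_ne_zero_of_re_pos {x : ℂ} (hx : 0 < x.re) (n : ℕ) : rise x n ≠ 0 := by
  refine rise_ne_zero fun i _ h => ?_
  have := congrArg Complex.re h
  simp at this
  have : (0 : ℝ) ≤ i := i.cast_nonneg
  linarith

theorem Gamma_add_nat {x : ℂ} {n : ℕ} (h : ∀ i < n, x + i ≠ 0) :
    Complex.Gamma (x + n) = rise x n * Complex.Gamma x := by
  induction n with
  | zero => simp [rise_zero]
  | succ n ih =>
    rw [Nat.cast_succ, ← add_assoc, Complex.Gamma_add_one _ (h n n.lt_succ_self),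
      ih fun i hi => h i (hi.trans n.lt_succ_self), rise_succ]
    ring

theorem ne_zero_of_re_pos {x : ℂ} (hx : 0 < x.re) : x ≠ 0 := by
  rintro rfl
  simp at hx

/-! ### The Beta functional on polynomials, with complex exponents. -/

/-- The Beta function in terms of Gamma functions. -/
def beta (s t : ℂ) : ℂ := Complex.Gamma s * Complex.Gamma t / Complex.Gamma (s + t)

theorem beta_ne_zero {s t : ℂ} (hs : 0 < s.re) (ht : 0 < t.re) : beta s t ≠ 0 :=
  div_ne_zero (mul_ne_zero (Complex.Gamma_ne_zero_of_re_pos hs)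
    (Complex.Gamma_ne_zero_of_re_pos ht))
    (Complex.Gamma_ne_zero_of_re_pos (by rw [Complex.add_re]; exact add_pos hs ht))

theorem beta_succ_left {s t : ℂ} (hs : 0 < s.re) (ht : 0 < t.re) :
    (s + t) * beta (s + 1) t = s * beta s t := by
  have hst : 0 < (s + t).re := by rw [Complex.add_re]; exact add_pos hs ht
  have h := Complex.Gamma_ne_zero_of_re_pos hst
  have h0 := ne_zero_of_re_pos hst
  rw [beta, beta, Complex.Gamma_add_one _ (ne_zero_of_re_pos hs),
    show s + 1 + t = s + t + 1 by ring, Complex.Gamma_add_one _ h0]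
  field_simp

theorem beta_succ_right {s t : ℂ} (hs : 0 < s.re) (ht : 0 < t.re) :
    beta s (t + 1) = beta s t - beta (s + 1) t := by
  have hst : 0 < (s + t).re := by rw [Complex.add_re]; exact add_pos hs ht
  have h := beta_succ_left hs ht
  have h' := beta_succ_left ht hs
  have h0 := ne_zero_of_re_pos hst
  have e : ∀ x y, beta x y = beta y x := fun x y => by
    rw [beta, beta, mul_comm, add_comm]
  rw [e t s, e (t + 1) s] at h'
  apply mul_left_cancel₀ h0
  linear_combination h' + h

/-- The linear functional `q ↦ ∫ q(x) x^(s-1) (1-x)^(t-1) dx`, given by its moments. -/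
def betaL (s t : ℂ) : ℂ[X] →ₗ[ℂ] ℂ :=
  Polynomial.lsum fun m => LinearMap.toSpanSingleton ℂ ℂ (beta (s + m) t)

theorem betaL_monomial (s t : ℂ) (m : ℕ) (c : ℂ) :
    betaL s t (monomial m c) = c * beta (s + m) t := by
  simp [betaL, Polynomial.lsum_apply]

theorem betaL_one (s t : ℂ) : betaL s t 1 = beta s t := by
  rw [← monomial_zero_one, betaL_monomial]
  simp

theorem betaL_C_mul (s t c : ℂ) (q : ℂ[X]) : betaL s t (C c * q) = c * betaL s t q := by
  rw [← smul_eq_C_mul, map_smul, smul_eq_mul]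

theorem betaL_X_mul (s t : ℂ) (q : ℂ[X]) : betaL s t (X * q) = betaL (s + 1) t q := by
  induction q using Polynomial.induction_on' with
  | add p q hp hq => rw [mul_add, map_add, map_add, hp, hq]
  | monomial m c =>
    rw [X_mul_monomial, betaL_monomial, betaL_monomial]
    push_cast
    rw [add_assoc, add_comm (m : ℂ)]

theorem re_add_nat_pos {s : ℂ} (hs : 0 < s.re) (m : ℕ) : 0 < (s + m).re := by
  rw [Complex.add_re, Complex.natCast_re]
  positivity

theorem betaL_one_sub_X_mul {s t : ℂ} (hs : 0 < s.re) (ht : 0 < t.re) (q : ℂ[X]) :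
    betaL s t ((1 - X) * q) = betaL s (t + 1) q := by
  rw [sub_mul, one_mul, map_sub, betaL_X_mul]
  induction q using Polynomial.induction_on' with
  | add p q hp hq =>
    simp only [map_add]
    rw [← hp, ← hq]
    ring
  | monomial m c =>
    simp only [betaL_monomial]
    rw [beta_succ_right (re_add_nat_pos hs m) ht]
    ring_nf

/-- The derivative of `x^s (1-x)^t q(x)` integrates to zero. -/
theorem betaL_deriv {s t : ℂ} (hs : 0 < s.re) (ht : 0 < t.re) (q : ℂ[X]) :
    betaL s t ((C s - C (s + t) * X) * q + X * (1 - X) * derivative q) = 0 := by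
  induction q using Polynomial.induction_on' with
  | add p q hp hq =>
    have e : (C s - C (s + t) * X) * (p + q) + X * (1 - X) * derivative (p + q) =
      ((C s - C (s + t) * X) * p + X * (1 - X) * derivative p) +
      ((C s - C (s + t) * X) * q + X * (1 - X) * derivative q) := by
      rw [derivative_add]; ring
    rw [e, map_add, hp, hq, add_zero]
  | monomial m c =>
    have hX : X * derivative (monomial m c) = C (m : ℂ) * monomial m c := by
      cases m with
      | zero => simp
      | succ m =>
        rw [derivative_monomial, X_mul_monomial, C_mul_monomial]
        simp [mul_comm]
    have e : (C s - C (s + t) * X) * monomial m c + X * (1 - X) * derivative (monomial m c) =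
        C (s + m) * monomial m c - C (s + m + t) * (X * monomial m c) := by
      rw [mul_assoc, mul_left_comm, hX]
      simp only [C_add]
      ring
    rw [e, map_sub, betaL_C_mul, betaL_C_mul, betaL_X_mul, betaL_monomial, betaL_monomial]
    have h := beta_succ_left (re_add_nat_pos hs m) ht
    rw [show s + 1 + m = s + m + 1 by ring]
    linear_combination -c * h

/-! ### Jacobi polynomials: Rodrigues' formula, derivatives, orthogonality. -/

/-- The monic Jacobi polynomials on `[0,1]` for the weight `x^(s-1) (1-x)^(t-1)`, generated by
Rodrigues' formula. -/
def jacobi : ℕ → ℂ → ℂ → ℂ[X]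
  | 0, _, _ => 1
  | n + 1, s, t =>
    C (-(s + t + n)⁻¹) * ((C s - C (s + t) * X) * jacobi n (s + 1) (t + 1) +
      X * (1 - X) * derivative (jacobi n (s + 1) (t + 1)))

/-- Integration by parts: the recursion says that p_{n+1} w is -(s+t+n)⁻¹ times the derivative of
x^s (1-x)^t P, with P the polynomial of degree n for the raised exponents. -/
theorem betaL_mul_jacobi_succ {s t : ℂ} (hs : 0 < s.re) (ht : 0 < t.re) (n : ℕ) (q : ℂ[X]) :
    betaL s t (q * jacobi (n + 1) s t) =
      (s + t + n)⁻¹ * betaL (s + 1) (t + 1) (derivative q * jacobi n (s + 1) (t + 1)) := by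
  set P := jacobi n (s + 1) (t + 1) with hP
  have h := betaL_deriv hs ht (q * P)
  have e : q * jacobi (n + 1) s t = C (-(s + t + n)⁻¹) *
      ((C s - C (s + t) * X) * (q * P) + X * (1 - X) * derivative (q * P)
        - X * ((1 - X) * (derivative q * P))) := by
    rw [jacobi, ← hP, derivative_mul]
    ring
  have hs1 : 0 < (s + 1).re := by simpa using re_add_nat_pos hs 1
  rw [e, betaL_C_mul, map_sub, h, betaL_X_mul, betaL_one_sub_X_mul hs1 ht]
  ring

theorem betaL_mul_jacobi {s t : ℂ} (hs : 0 < s.re) (ht : 0 < t.re) (n : ℕ) (q : ℂ[X]) :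
    betaL s t (q * jacobi n s t) =
      (rise (s + t + n - 1) n)⁻¹ * betaL (s + n) (t + n) (derivative^[n] q) := by
  induction n generalizing s t q with
  | zero => simp [rise_zero, jacobi]
  | succ n ih =>
    have hs1 : 0 < (s + 1).re := by simpa using re_add_nat_pos hs 1
    have ht1 : 0 < (t + 1).re := by simpa using re_add_nat_pos ht 1
    rw [betaL_mul_jacobi_succ hs ht, ih hs1 ht1, rise_succ_left, mul_inv, ← mul_assoc,
      Function.iterate_succ_apply]
    push_cast
    ring_nf

/-- The moments `∫ x^k p_n(x) x^(s-1) (1-x)^(t-1) dx` for complex `k`. -/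
theorem betaL_jacobi_shift {s t k : ℂ} (hs : 0 < (s + k).re) (ht : 0 < t.re) (n : ℕ) :
    betaL (s + k) t (jacobi n s t) =
      fall k n * (rise (s + t + n - 1) n)⁻¹ * beta (s + k) (t + n) := by
  induction n generalizing s t k with
  | zero => simp [rise_zero, fall_zero, jacobi, betaL_one]
  | succ n ih =>
    have ht1 : 0 < (t + 1).re := by simpa using re_add_nat_pos ht 1
    have hsk : s + 1 + (k - 1) = s + k := by ring
    set P := jacobi n (s + 1) (t + 1) with hP
    have h := betaL_deriv hs ht P
    -- Rewriting the bracket with s + k in place of s makes it an exact derivative for the weight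
    -- with exponent s + k; the correction -k (1-x) P produces the factor k of the falling
    -- factorial.
    have e : jacobi (n + 1) s t = C (-(s + t + n)⁻¹) *
        (((C (s + k) - C (s + k + t) * X) * P + X * (1 - X) * derivative P)
          - C k * ((1 - X) * P)) := by
      rw [jacobi, ← hP]
      simp only [C_add]
      ring
    have h2 := ih (s := s + 1) (t := t + 1) (k := k - 1) (by rwa [hsk]) ht1
    rw [hsk, ← hP] at h2
    rw [e, betaL_C_mul, map_sub, h, betaL_C_mul, betaL_one_sub_X_mul hs ht, h2, fall_succ_left,
      rise_succ_left, mul_inv]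
    push_cast
    ring_nf

theorem derivative_jacobi_succ {s t : ℂ} (hst : 0 < (s + t).re) (n : ℕ) :
    derivative (jacobi (n + 1) s t) = C (n + 1 : ℂ) * jacobi n (s + 1) (t + 1) := by
  induction n generalizing s t with
  | zero =>
    have h0 := ne_zero_of_re_pos hst
    simp only [jacobi, zero_add, CharP.cast_eq_zero, add_zero, derivative_one, mul_zero, mul_one,
      derivative_mul, derivative_C, zero_mul, derivative_sub, derivative_X, zero_sub, C_1]
    rw [← C_neg, ← C_mul, neg_mul_neg, inv_mul_cancel₀ h0, C_1]
  | succ n ih =>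
    have hst' : 0 < (s + 1 + (t + 1)).re := by
      simp only [Complex.add_re, Complex.one_re] at hst ⊢
      linarith
    have h0 : s + t + ((n + 1 : ℕ) : ℂ) ≠ 0 := ne_zero_of_re_pos (re_add_nat_pos hst _)
    have h1 : s + 1 + (t + 1) + (n : ℂ) ≠ 0 := ne_zero_of_re_pos (re_add_nat_pos hst' _)
    have ihP := ih hst'
    have hdef : jacobi (n + 1) (s + 1) (t + 1) = C (-(s + 1 + (t + 1) + n)⁻¹) *
        ((C (s + 1) - C (s + 1 + (t + 1)) * X) * jacobi n (s + 1 + 1) (t + 1 + 1) +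
        X * (1 - X) * derivative (jacobi n (s + 1 + 1) (t + 1 + 1))) := rfl
    set P := jacobi (n + 1) (s + 1) (t + 1) with hP
    set Q := jacobi n (s + 1 + 1) (t + 1 + 1) with hQ
    have hR : (C (s + 1) - C (s + 1 + (t + 1)) * X) * Q + X * (1 - X) * derivative Q =
        C (-(s + 1 + (t + 1) + n)) * P := by
      rw [hdef, ← mul_assoc, ← C_mul, neg_mul_neg, mul_inv_cancel₀ h1, C_1, one_mul]
    have e : jacobi (n + 1 + 1) s t = C (-(s + t + (n + 1 : ℕ))⁻¹) *
        ((C s - C (s + t) * X) * P + X * (1 - X) * derivative P) := rfl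
    rw [e, derivative_mul, derivative_C, zero_mul, zero_add, derivative_add, derivative_mul,
      derivative_mul, derivative_mul, ihP, derivative_mul]
    -- With P' = (n+1) Q, every Q-term collects into the Rodrigues expression for P, hence into a
    -- multiple of P. The constants match by (s+t) + (n+1)(s+t+n+2) = (n+2)(s+t+n+1).
    have key : C (s + t + (n + 1 : ℕ)) * (C ((n + 1 : ℕ) + 1 : ℂ) * P) =
        -(derivative (C s - C (s + t) * X) * P + (C s - C (s + t) * X) * (C (n + 1 : ℂ) * Q) +
        ((derivative X * (1 - X) + X * derivative (1 - X)) * (C (n + 1 : ℂ) * Q) +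
        X * (1 - X) * (derivative (C (n + 1 : ℂ)) * Q + C (n + 1 : ℂ) * derivative Q))) := by
      simp only [derivative_sub, derivative_C, derivative_mul, derivative_X, derivative_one]
      simp only [C_add, C_neg, C_1, Nat.cast_add, Nat.cast_one] at hR ⊢
      linear_combination (C (n : ℂ) + 1) * hR
    rw [C_neg, neg_mul, ← mul_neg, ← key, ← mul_assoc, ← C_mul, inv_mul_cancel₀ h0, C_1, one_mul]

theorem iterate_derivative_jacobi {s t : ℂ} (hst : 0 < (s + t).re) (i n : ℕ) :
    derivative^[i] (jacobi (n + i) s t) =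
      C (((n + i).factorial : ℂ) / n.factorial) * jacobi n (s + i) (t + i) := by
  induction i generalizing s t with
  | zero =>
    have : (n.factorial : ℂ) ≠ 0 := by exact_mod_cast n.factorial_ne_zero
    simp [this]
  | succ i ih =>
    have hst' : 0 < (s + 1 + (t + 1)).re := by
      simp only [Complex.add_re, Complex.one_re] at hst ⊢
      linarith
    rw [Function.iterate_succ_apply, ← add_assoc, derivative_jacobi_succ hst,
      iterate_derivative_C_mul, ih hst', ← mul_assoc, ← C_mul, Nat.factorial_succ]
    push_cast
    ring_nf

theorem natDegree_jacobi_le (n : ℕ) (s t : ℂ) : (jacobi n s t).natDegree ≤ n := by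
  induction n generalizing s t with
  | zero => simp [jacobi]
  | succ n ih =>
    have h := ih (s + 1) (t + 1)
    rw [jacobi]
    refine (natDegree_C_mul_le _ _).trans ?_
    refine natDegree_add_le_of_degree_le ?_ ?_
    · refine natDegree_mul_le.trans ?_
      have : (C s - C (s + t) * X : ℂ[X]).natDegree ≤ 1 := by compute_degree
      omega
    · rw [natDegree_le_iff_coeff_eq_zero]
      intro m hm
      obtain ⟨m, rfl⟩ : ∃ l, m = l + 2 := ⟨m - 2, by omega⟩
      rw [mul_assoc, coeff_X_mul, sub_mul, one_mul, coeff_sub, coeff_X_mul, coeff_derivative,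
        coeff_derivative, coeff_eq_zero_of_natDegree_lt (by omega),
        coeff_eq_zero_of_natDegree_lt (by omega)]
      simp

theorem coeff_jacobi_succ (n : ℕ) (s t : ℂ) (m : ℕ) :
    (jacobi (n + 1) s t).coeff (m + 1) = -(s + t + n)⁻¹ *
      ((s + m + 1) * (jacobi n (s + 1) (t + 1)).coeff (m + 1) -
        (s + t + m) * (jacobi n (s + 1) (t + 1)).coeff m) := by
  have hX (p : ℂ[X]) : (X * derivative p).coeff m = m * p.coeff m := by
    cases m with
    | zero => simp
    | succ m => rw [coeff_X_mul, coeff_derivative]; push_cast; ring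
  rw [jacobi, coeff_C_mul, coeff_add, mul_assoc X, coeff_X_mul, sub_mul, sub_mul, coeff_sub,
    coeff_sub, coeff_C_mul, mul_assoc, coeff_C_mul, coeff_X_mul, one_mul, hX, coeff_derivative]
  ring

theorem coeff_jacobi_self {s t : ℂ} (hst : 0 < (s + t).re) (n : ℕ) :
    (jacobi n s t).coeff n = 1 := by
  induction n generalizing s t with
  | zero => simp [jacobi]
  | succ n ih =>
    have hst' : 0 < (s + 1 + (t + 1)).re := by
      simp only [Complex.add_re, Complex.one_re] at hst ⊢
      linarith
    have h0 : s + t + (n : ℂ) ≠ 0 := ne_zero_of_re_pos (re_add_nat_pos hst _)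
    rw [coeff_jacobi_succ, ih hst',
      coeff_eq_zero_of_natDegree_lt (lt_of_le_of_lt (natDegree_jacobi_le n _ _) n.lt_succ_self)]
    field_simp
    ring

theorem coeff_jacobi_pred {s t : ℂ} (hst : 0 < (s + t).re) (n : ℕ) :
    (jacobi (n + 1) s t).coeff n = -((n + 1) * (s + n)) / (s + t + 2 * n) := by
  induction n generalizing s t with
  | zero =>
    have h0 := ne_zero_of_re_pos hst
    simp [jacobi]
    field_simp
  | succ n ih =>
    have hst' : 0 < (s + 1 + (t + 1)).re := by
      simp only [Complex.add_re, Complex.one_re] at hst ⊢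
      linarith
    have h0 : s + t + ((n : ℂ) + 1) ≠ 0 := by
      simpa using ne_zero_of_re_pos (re_add_nat_pos hst (n + 1))
    have h1 : s + t + 2 * ((n : ℂ) + 1) ≠ 0 := by
      simpa using ne_zero_of_re_pos (re_add_nat_pos hst (2 * (n + 1)))
    have h2 : s + 1 + (t + 1) + 2 * (n : ℂ) ≠ 0 := by
      convert h1 using 1; ring
    rw [coeff_jacobi_succ, ih hst', coeff_jacobi_self hst']
    push_cast
    have hf := div_mul_cancel₀ (-(((n : ℂ) + 1) * (s + 1 + n))) h2
    rw [neg_mul, ← mul_neg, inv_mul_eq_div, div_eq_div_iff h0 h1]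
    linear_combination (s + t + n) * hf

theorem monic_jacobi {s t : ℂ} (hst : 0 < (s + t).re) (n : ℕ) : (jacobi n s t).Monic :=
  monic_of_natDegree_le_of_coeff_eq_one n (natDegree_jacobi_le n s t) (coeff_jacobi_self hst n)

theorem natDegree_jacobi {s t : ℂ} (hst : 0 < (s + t).re) (n : ℕ) :
    (jacobi n s t).natDegree = n :=
  natDegree_eq_of_le_of_coeff_ne_zero (natDegree_jacobi_le n s t)
    (by rw [coeff_jacobi_self hst]; exact one_ne_zero)

/-- The squared norm of the monic Jacobi polynomial. -/
def normSq (n : ℕ) (s t : ℂ) : ℂ :=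
  n.factorial * (rise (s + t + n - 1) n)⁻¹ * beta (s + n) (t + n)

theorem normSq_ne_zero {s t : ℂ} (hs : 0 < s.re) (ht : 0 < t.re) (n : ℕ) :
    normSq n s t ≠ 0 := by
  refine mul_ne_zero (mul_ne_zero (by exact_mod_cast n.factorial_ne_zero) (inv_ne_zero ?_))
    (beta_ne_zero (re_add_nat_pos hs n) (re_add_nat_pos ht n))
  cases n with
  | zero => simp [rise_zero]
  | succ n =>
    apply rise_ne_zero_of_re_pos
    rw [Nat.cast_succ, ← add_assoc, add_sub_cancel_right]
    apply re_add_nat_pos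
    rw [Complex.add_re]
    exact add_pos hs ht

theorem iterate_derivative_eq_C {n : ℕ} {q : ℂ[X]} (hq : q.natDegree ≤ n) :
    derivative^[n] q = C (n.factorial * q.coeff n) := by
  ext m
  rw [coeff_iterate_derivative, coeff_C]
  split_ifs with h
  · subst h
    simp [Nat.descFactorial_self]
  · rw [coeff_eq_zero_of_natDegree_lt (by omega), smul_zero]

theorem betaL_mul_jacobi_of_natDegree_le {s t : ℂ} (hs : 0 < s.re) (ht : 0 < t.re) {n : ℕ}
    {q : ℂ[X]} (hq : q.natDegree ≤ n) :
    betaL s t (q * jacobi n s t) = q.coeff n * normSq n s t := by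
  rw [betaL_mul_jacobi hs ht, iterate_derivative_eq_C hq, ← mul_one (C _), betaL_C_mul, betaL_one,
    normSq]
  ring

theorem betaL_jacobi_mul_jacobi {s t : ℂ} (hs : 0 < s.re) (ht : 0 < t.re) (m n : ℕ) :
    betaL s t (jacobi m s t * jacobi n s t) = if m = n then normSq n s t else 0 := by
  have hst : 0 < (s + t).re := by rw [Complex.add_re]; exact add_pos hs ht
  have key {m n : ℕ} (h : m < n) : betaL s t (jacobi m s t * jacobi n s t) = 0 := by
    rw [betaL_mul_jacobi_of_natDegree_le hs ht ((natDegree_jacobi_le m s t).trans h.le),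
      coeff_eq_zero_of_natDegree_lt ((natDegree_jacobi_le m s t).trans_lt h), zero_mul]
  split_ifs with h
  · subst h
    rw [betaL_mul_jacobi_of_natDegree_le hs ht (natDegree_jacobi_le m s t),
      coeff_jacobi_self hst, one_mul]
  · rcases lt_or_gt_of_ne h with h | h
    · exact key h
    · rw [mul_comm]
      exact key h

/-- Replaces positivity, absent for complex exponents: pairing q with the Jacobi polynomial of its
own degree gives leading coefficient times a nonzero norm. -/
theorem eq_zero_of_orthogonal {s t : ℂ} (hs : 0 < s.re) (ht : 0 < t.re) {n : ℕ} {q : ℂ[X]}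
    (hq : q.natDegree ≤ n) (h : ∀ m ≤ n, betaL s t (q * jacobi m s t) = 0) : q = 0 := by
  by_contra h0
  have h1 := h _ hq
  rw [betaL_mul_jacobi_of_natDegree_le hs ht le_rfl] at h1
  exact mul_ne_zero (leadingCoeff_ne_zero.2 h0) (normSq_ne_zero hs ht _) h1

theorem eq_sum_jacobi {s t : ℂ} (hs : 0 < s.re) (ht : 0 < t.re) {n : ℕ} {q : ℂ[X]}
    (hq : q.natDegree ≤ n) :
    q = ∑ i ∈ Finset.range (n + 1),
      C (betaL s t (q * jacobi i s t) / normSq i s t) * jacobi i s t := by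
  refine sub_eq_zero.1 (eq_zero_of_orthogonal hs ht (n := n) ?_ fun m hm => ?_)
  · refine (natDegree_sub_le_of_le hq (natDegree_sum_le_of_forall_le _ _ fun i hi => ?_)).trans
      (max_self n).le
    exact (natDegree_C_mul_le _ _).trans
      ((natDegree_jacobi_le i s t).trans (Nat.lt_succ_iff.1 (Finset.mem_range.1 hi)))
  · rw [sub_mul, map_sub, Finset.sum_mul, map_sum, Finset.sum_eq_single m]
    · rw [mul_assoc, betaL_C_mul, betaL_jacobi_mul_jacobi hs ht, if_pos rfl,
        div_mul_cancel₀ _ (normSq_ne_zero hs ht m), sub_self]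
    · intro i _ hi
      rw [mul_assoc, betaL_C_mul, betaL_jacobi_mul_jacobi hs ht, if_neg hi, mul_zero]
    · intro h
      exact absurd (Finset.mem_range.2 (Nat.lt_succ_iff.2 hm)) h

/-! ### The skew-symmetric operator and the telescoping sum. -/

/-- The first order operator `q ↦ (s - (s+t) x) q + 2 x (1-x) q'`, which is skew-symmetric for the
weight `x^(s-1) (1-x)^(t-1)`. -/
def skewOp (s t : ℂ) (q : ℂ[X]) : ℂ[X] :=
  (C s - C (s + t) * X) * q + 2 * (X * (1 - X)) * derivative q

theorem betaL_skewOp_mul {s t : ℂ} (hs : 0 < s.re) (ht : 0 < t.re) (q r : ℂ[X]) :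
    betaL s t (skewOp s t q * r) = -betaL s t (q * skewOp s t r) := by
  have h := betaL_deriv hs ht (q * r)
  have e : skewOp s t q * r = C 2 * ((C s - C (s + t) * X) * (q * r) +
      X * (1 - X) * derivative (q * r)) - q * skewOp s t r := by
    rw [skewOp, skewOp, derivative_mul, C_ofNat]
    ring
  rw [e, map_sub, betaL_C_mul, h, mul_zero, zero_sub]

theorem coeff_skewOp (s t : ℂ) (q : ℂ[X]) (m : ℕ) :
    (skewOp s t q).coeff (m + 1) =
      (s + 2 * (m + 1)) * q.coeff (m + 1) - (s + t + 2 * m) * q.coeff m := by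
  have hX (p : ℂ[X]) : (X * derivative p).coeff m = m * p.coeff m := by
    cases m with
    | zero => simp
    | succ m => rw [coeff_X_mul, coeff_derivative]; push_cast; ring
  rw [skewOp, coeff_add, ← C_ofNat, mul_assoc, coeff_C_mul, mul_assoc, coeff_X_mul, sub_mul,
    sub_mul, coeff_sub, coeff_sub, coeff_C_mul, mul_assoc, coeff_C_mul, coeff_X_mul, one_mul, hX,
    coeff_derivative]
  ring

theorem natDegree_skewOp_le (s t : ℂ) {n : ℕ} {q : ℂ[X]} (hq : q.natDegree ≤ n) :
    (skewOp s t q).natDegree ≤ n + 1 := by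
  rw [natDegree_le_iff_coeff_eq_zero]
  intro m hm
  obtain ⟨m, rfl⟩ : ∃ l, m = l + 1 := ⟨m - 1, by omega⟩
  rw [coeff_skewOp, coeff_eq_zero_of_natDegree_lt (by omega),
    coeff_eq_zero_of_natDegree_lt (by omega)]
  simp

theorem betaL_skewOp_jacobi_of_lt {s t : ℂ} (hs : 0 < s.re) (ht : 0 < t.re) {m n : ℕ}
    (h : m < n) :
    betaL s t (skewOp s t (jacobi m s t) * jacobi n s t) =
      if n = m + 1 then -(s + t + 2 * m) * normSq n s t else 0 := by
  have hst : 0 < (s + t).re := by rw [Complex.add_re]; exact add_pos hs ht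
  have hd := natDegree_skewOp_le s t (natDegree_jacobi_le m s t)
  rw [betaL_mul_jacobi_of_natDegree_le hs ht (hd.trans h)]
  split_ifs with e
  · subst e
    rw [coeff_skewOp, coeff_jacobi_self hst,
      coeff_eq_zero_of_natDegree_lt (Nat.lt_succ_of_le (natDegree_jacobi_le m s t))]
    ring
  · rw [coeff_eq_zero_of_natDegree_lt (by omega), zero_mul]

theorem betaL_skewOp_mul_self {s t : ℂ} (hs : 0 < s.re) (ht : 0 < t.re) (q : ℂ[X]) :
    betaL s t (skewOp s t q * q) = 0 := by
  have h := betaL_skewOp_mul hs ht q q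
  rw [mul_comm q] at h
  exact self_eq_neg.1 h

theorem betaL_skewOp_jacobi_of_gt {s t : ℂ} (hs : 0 < s.re) (ht : 0 < t.re) {m n : ℕ}
    (h : n < m) :
    betaL s t (skewOp s t (jacobi m s t) * jacobi n s t) =
      if m = n + 1 then (s + t + 2 * n) * normSq m s t else 0 := by
  rw [betaL_skewOp_mul hs ht, mul_comm, betaL_skewOp_jacobi_of_lt hs ht h]
  split_ifs <;> ring

theorem skewOp_jacobi_zero {s t : ℂ} (hst : s + t ≠ 0) :
    skewOp s t (jacobi 0 s t) = C (-(s + t)) * jacobi 1 s t := by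
  simp only [skewOp, jacobi, derivative_one, mul_zero, add_zero, mul_one, Nat.cast_zero]
  rw [← mul_assoc, ← C_mul, neg_mul_neg, mul_inv_cancel₀ hst, C_1, one_mul]

/-- An operator raising degree by at most one is upper Hessenberg in the Jacobi basis; skew-symmetry
makes it tridiagonal with zero diagonal and fixes the lower coefficient from the upper one. -/
theorem skewOp_jacobi_succ {s t : ℂ} (hs : 0 < s.re) (ht : 0 < t.re) (n : ℕ) :
    skewOp s t (jacobi (n + 1) s t) =
      C (-(s + t + 2 * (n + 1))) * jacobi (n + 2) s t +
      C ((s + t + 2 * n) * normSq (n + 1) s t / normSq n s t) * jacobi n s t := by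
  refine sub_eq_zero.1 (eq_zero_of_orthogonal hs ht (n := n + 2) ?_ fun m hm => ?_)
  · refine (natDegree_sub_le_of_le (natDegree_skewOp_le s t (natDegree_jacobi_le _ _ _))
      (natDegree_add_le_of_degree_le ((natDegree_C_mul_le _ _).trans (natDegree_jacobi_le _ _ _))
      ((natDegree_C_mul_le _ _).trans ((natDegree_jacobi_le _ _ _).trans (by omega))))).trans
      (max_self _).le
  · have h0 := normSq_ne_zero hs ht n
    rw [sub_mul, add_mul, map_sub, map_add, mul_assoc, mul_assoc, betaL_C_mul, betaL_C_mul,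
      betaL_jacobi_mul_jacobi hs ht, betaL_jacobi_mul_jacobi hs ht]
    rcases lt_trichotomy m (n + 1) with h | h | h
    · rw [betaL_skewOp_jacobi_of_gt hs ht h, if_neg (show ¬ n + 2 = m by omega)]
      by_cases e : n = m
      · subst e
        simp only [if_true]
        field_simp
        ring
      · rw [if_neg e, if_neg (by omega)]
        ring
    · subst h
      rw [betaL_skewOp_mul_self hs ht, if_neg (by omega), if_neg (by omega)]
      ring
    · obtain rfl : m = n + 2 := by omega
      rw [betaL_skewOp_jacobi_of_lt hs ht h, if_pos rfl, if_pos rfl, if_neg (by omega)]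
      push_cast
      ring

/-- The derivative of x^(s+k) (1-x)^t q² integrates to zero; the part of it proportional to k is
split off, and the rest is `skewOp s t q * q`, free of k. -/
theorem betaL_one_sub_X_mul_sq {s t k : ℂ} (hs : 0 < (s + k).re) (ht : 0 < t.re) (q : ℂ[X]) :
    k * betaL (s + k) t ((1 - X) * (q * q)) = -betaL (s + k) t (skewOp s t q * q) := by
  have h := betaL_deriv hs ht (q * q)
  have e : (C (s + k) - C (s + k + t) * X) * (q * q) + X * (1 - X) * derivative (q * q) =
      C k * ((1 - X) * (q * q)) + skewOp s t q * q := by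
    rw [skewOp, derivative_mul]
    simp only [C_add]
    ring
  rw [e, map_add, betaL_C_mul] at h
  linear_combination h

/-- The telescoped form of the Christoffel-Darboux derivative formula. -/
theorem sum_betaL_one_sub_X_mul_sq {s t k : ℂ} (hs : 0 < s.re) (hsk : 0 < (s + k).re)
    (ht : 0 < t.re) (n : ℕ) :
    k * ∑ i ∈ Finset.range (n + 1),
      betaL (s + k) t ((1 - X) * (jacobi i s t * jacobi i s t)) / normSq i s t =
    (s + t + 2 * n) / normSq n s t * betaL (s + k) t (jacobi (n + 1) s t * jacobi n s t) := by
  have hst : 0 < (s + t).re := by rw [Complex.add_re]; exact add_pos hs ht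
  induction n with
  | zero =>
    rw [Finset.sum_range_one, ← mul_div_assoc, betaL_one_sub_X_mul_sq hsk ht,
      skewOp_jacobi_zero (ne_zero_of_re_pos hst), mul_assoc, betaL_C_mul]
    push_cast
    ring
  | succ n ih =>
    -- The p_n term of the operator applied to p_{n+1} cancels the boundary term of the induction
    -- hypothesis; the p_{n+2} term is the new boundary term.
    have h0 := normSq_ne_zero hs ht n
    have h1 := normSq_ne_zero hs ht (n + 1)
    rw [Finset.sum_range_succ, mul_add, ih, ← mul_div_assoc, betaL_one_sub_X_mul_sq hsk ht,
      skewOp_jacobi_succ hs ht, add_mul, map_add, mul_assoc, mul_assoc, betaL_C_mul, betaL_C_mul,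
      mul_comm (jacobi n s t)]
    push_cast
    field_simp
    ring

/-! ### Connection coefficients between the exponents s and s + k. -/

/-- The coefficients connecting Jacobi polynomials for the weights with exponents `s` and
`s + k`. -/
theorem betaL_jacobi_mul_jacobi_shift {s t k : ℂ} (hs : 0 < s.re) (hsk : 0 < (s + k).re)
    (ht : 0 < t.re) (m i : ℕ) :
    betaL (s + k) t (jacobi (m + i) s t * jacobi i (s + k) t) =
      (rise (s + k + t + i - 1) i)⁻¹ * ((m + i).factorial / m.factorial) *
      (fall k m * (rise (s + t + m + 2 * i - 1) m)⁻¹ * beta (s + k + i) (t + m + i)) := by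
  have hst : 0 < (s + t).re := by rw [Complex.add_re]; exact add_pos hs ht
  have e : s + k + i = s + i + k := by ring
  have hski : 0 < (s + i + k).re := by rw [← e]; exact re_add_nat_pos hsk i
  -- Rodrigues for the second factor moves i derivatives onto the first, leaving a degree m Jacobi
  -- polynomial with exponents s + i, t + i, whose k-th moment is known.
  rw [betaL_mul_jacobi hsk ht, iterate_derivative_jacobi hst, betaL_C_mul, e,
    betaL_jacobi_shift hski (re_add_nat_pos ht i)]
  ring_nf

theorem betaL_jacobi_mul_jacobi_eq_sum {s t k : ℂ} (hsk : 0 < (s + k).re) (ht : 0 < t.re)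
    (n : ℕ) :
    betaL (s + k) t (jacobi (n + 1) s t * jacobi n s t) =
      ∑ i ∈ Finset.range (n + 1),
        betaL (s + k) t (jacobi n s t * jacobi i (s + k) t) *
        betaL (s + k) t (jacobi (n + 1) s t * jacobi i (s + k) t) / normSq i (s + k) t := by
  conv_lhs => rw [eq_sum_jacobi hsk ht (natDegree_jacobi_le n s t)]
  rw [Finset.mul_sum, map_sum]
  refine Finset.sum_congr rfl fun i _ => ?_
  rw [mul_left_comm, betaL_C_mul]
  ring

/-! ### The first moment, from subleading coefficients. -/

/-- x p_n - p_{n+1} has degree at most n, so pairing it with p_n reads off its n-th coefficient. The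
right-hand side telescopes when summed over n. -/
theorem betaL_X_mul_jacobi_sq {s t : ℂ} (hs : 0 < s.re) (ht : 0 < t.re) (n : ℕ) :
    betaL s t (X * (jacobi n s t * jacobi n s t)) / normSq n s t =
      (X * jacobi n s t).coeff n - (jacobi (n + 1) s t).coeff n := by
  have hst : 0 < (s + t).re := by rw [Complex.add_re]; exact add_pos hs ht
  have hd : (X * jacobi n s t - jacobi (n + 1) s t).natDegree ≤ n := by
    rw [natDegree_le_iff_coeff_eq_zero]
    intro m hm
    obtain ⟨m, rfl⟩ : ∃ l, m = l + 1 := ⟨m - 1, by omega⟩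
    rw [coeff_sub, coeff_X_mul]
    rcases (Nat.lt_succ_iff.1 hm).eq_or_lt with rfl | h
    · rw [coeff_jacobi_self hst, coeff_jacobi_self hst, sub_self]
    · rw [coeff_eq_zero_of_natDegree_lt ((natDegree_jacobi_le n s t).trans_lt h),
        coeff_eq_zero_of_natDegree_lt
          ((natDegree_jacobi_le (n + 1) s t).trans_lt (Nat.succ_lt_succ h)), sub_zero]
  have h := betaL_mul_jacobi_of_natDegree_le hs ht hd
  rw [sub_mul, map_sub, betaL_jacobi_mul_jacobi hs ht, if_neg (by omega), sub_zero, coeff_sub,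
    mul_assoc] at h
  rw [h, mul_div_cancel_right₀ _ (normSq_ne_zero hs ht n)]

theorem sum_betaL_X_mul_jacobi_sq {s t : ℂ} (hs : 0 < s.re) (ht : 0 < t.re) (n : ℕ) :
    ∑ i ∈ Finset.range (n + 1),
      betaL s t (X * (jacobi i s t * jacobi i s t)) / normSq i s t =
      (n + 1) * (s + n) / (s + t + 2 * n) := by
  have hst : 0 < (s + t).re := by rw [Complex.add_re]; exact add_pos hs ht
  have h : ∑ i ∈ Finset.range (n + 1),
      betaL s t (X * (jacobi i s t * jacobi i s t)) / normSq i s t =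
      -(jacobi (n + 1) s t).coeff n := by
    induction n with
    | zero => simp [betaL_X_mul_jacobi_sq hs ht]
    | succ n ih =>
      rw [Finset.sum_range_succ, ih, betaL_X_mul_jacobi_sq hs ht, coeff_X_mul]
      ring
  rw [h, coeff_jacobi_pred hst, neg_div, neg_neg]

/-! ### Pole-free coefficients and their comparison with U. -/

/-- The coefficient `U` for the ensemble of size `n + 1` and `j = n + 1 - i`, in the variables
`s = b + 1`, `t = a + 1`, after cancellation of the poles of the Gamma factors. -/
def coeffV (n : ℕ) (s t k : ℂ) (i : ℕ) : ℂ :=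
  ((n + 1).factorial / i.factorial) * (Complex.Gamma (s + k + i) / Complex.Gamma (s + n)) *
    (Complex.Gamma (t + n + 1) / Complex.Gamma (t + i)) *
    (rise (s + t + n - 1) i * Complex.Gamma (s + t + n + i)) *
    (Complex.Gamma (s + t + k + 2 * i) / rise (s + t + k + i - 1) i) /
    (Complex.Gamma (s + t + k + n + i + 1) * Complex.Gamma (s + t + k + n + i))

theorem re_pos_of_eq_add_nat {x y : ℂ} (hx : 0 < x.re) (m : ℕ) (h : y = x + m) : 0 < y.re :=
  h ▸ re_add_nat_pos hx m

theorem rise_sub_one_ne_zero {x : ℂ} (hx : 0 < x.re) (n : ℕ) : rise (x + n - 1) n ≠ 0 := by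
  cases n with
  | zero => simp [rise_zero]
  | succ n =>
    apply rise_ne_zero_of_re_pos
    rw [Nat.cast_succ, ← add_assoc, add_sub_cancel_right]
    exact re_add_nat_pos hx n

theorem coeffV_eq {s t k : ℂ} (hs : 0 < s.re) (hsk : 0 < (s + k).re) (ht : 0 < t.re)
    (m i : ℕ) :
    (s + t + 2 * (m + i : ℕ)) / normSq (m + i) s t *
      (betaL (s + k) t (jacobi (m + i) s t * jacobi i (s + k) t) *
        betaL (s + k) t (jacobi (m + i + 1) s t * jacobi i (s + k) t) / normSq i (s + k) t) =
      fall k m / m.factorial * (fall k (m + 1) / (m + 1).factorial) *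
        coeffV (m + i) s t k i := by
  have hst : 0 < (s + t).re := by rw [Complex.add_re]; exact add_pos hs ht
  have hstk : 0 < (s + t + k).re := by
    rw [show s + t + k = s + k + t by ring, Complex.add_re]; exact add_pos hsk ht
  have hG {x y : ℂ} (hx : 0 < x.re) (l : ℕ) (h : y = x + l) : Complex.Gamma y ≠ 0 :=
    Complex.Gamma_ne_zero_of_re_pos (re_pos_of_eq_add_nat hx l h)
  rw [show m + i + 1 = m + 1 + i by ring, betaL_jacobi_mul_jacobi_shift hs hsk ht,
    betaL_jacobi_mul_jacobi_shift hs hsk ht, normSq, normSq, beta, beta, beta, beta, coeffV]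
  have e1 : rise (s + t + (m + i : ℕ) - 1) (m + i) =
      rise (s + t + m + i - 1) i * rise (s + t + m + 2 * i - 1) m := by
    rw [add_comm m i, rise_add]; push_cast; ring_nf
  -- Both sides are Γ(s + t + 2(m+i) + 1). This absorbs the prefactor of the telescoped sum, and
  -- after `e1` it is the only Gamma identity needed.
  have e2 : (s + t + 2 * (m + i : ℕ)) * Complex.Gamma (s + t + 2 * (m + i : ℕ)) =
      rise (s + t + (m + 1 : ℕ) + 2 * i - 1) (m + 1) * Complex.Gamma (s + t + m + 2 * i) := by
    have h : 0 < (s + t + m + 2 * i).re :=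
      re_pos_of_eq_add_nat hst (m + 2 * i) (by push_cast; ring)
    rw [← Complex.Gamma_add_one _ (ne_zero_of_re_pos
      (re_pos_of_eq_add_nat hst (2 * (m + i)) (by push_cast; ring))),
      show s + t + (m + 1 : ℕ) + 2 * i - 1 = s + t + m + 2 * i by push_cast; ring,
      ← Gamma_add_nat (n := m + 1) fun l _ => ne_zero_of_re_pos (re_add_nat_pos h l)]
    push_cast
    ring_nf
  have n1 := rise_sub_one_ne_zero hst (m + i)
  rw [e1] at n1 ⊢
  have n2 := left_ne_zero_of_mul n1
  have n3 := right_ne_zero_of_mul n1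
  have n4 : rise (s + t + (m + 1 : ℕ) + 2 * i - 1) (m + 1) ≠ 0 := by
    apply rise_ne_zero_of_re_pos
    exact re_pos_of_eq_add_nat hst (m + 2 * i) (by push_cast; ring)
  have n5 : rise (s + k + t + i - 1) i ≠ 0 :=
    rise_sub_one_ne_zero (by rwa [show s + k + t = s + t + k by ring]) i
  have f1 : ((m + i).factorial : ℂ) ≠ 0 := by exact_mod_cast (m + i).factorial_ne_zero
  have f2 : (m.factorial : ℂ) ≠ 0 := by exact_mod_cast m.factorial_ne_zero
  have f3 : ((m + 1).factorial : ℂ) ≠ 0 := by exact_mod_cast (m + 1).factorial_ne_zero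
  have f4 : (i.factorial : ℂ) ≠ 0 := by exact_mod_cast i.factorial_ne_zero
  have g1 : Complex.Gamma (s + (m + i : ℕ)) ≠ 0 := hG hs (m + i) rfl
  have g2 : Complex.Gamma (t + (m + i : ℕ)) ≠ 0 := hG ht (m + i) rfl
  have g3 : Complex.Gamma (s + k + i) ≠ 0 := hG hsk i rfl
  have g4 : Complex.Gamma (t + i) ≠ 0 := hG ht i rfl
  have g5 : Complex.Gamma (s + t + k + 2 * i) ≠ 0 := hG hstk (2 * i) (by push_cast; ring)
  have g6 : Complex.Gamma (s + t + 2 * (m + i : ℕ)) ≠ 0 :=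
    hG hst (2 * (m + i)) (by push_cast; ring)
  have g7 : Complex.Gamma (s + t + k + (m + i : ℕ) + i) ≠ 0 :=
    hG hstk (m + i + i) (by push_cast; ring)
  have g8 : Complex.Gamma (s + t + k + (m + i : ℕ) + i + 1) ≠ 0 :=
    hG hstk (m + i + i + 1) (by push_cast; ring)
  rw [show s + (m + i : ℕ) + (t + (m + i : ℕ)) = s + t + 2 * (m + i : ℕ) by ring,
    show t + m + i = t + (m + i : ℕ) by push_cast; ring,
    show s + k + i + (t + (m + i : ℕ)) = s + t + k + (m + i : ℕ) + i by ring,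
    show t + (m + 1 : ℕ) + i = t + (m + i : ℕ) + 1 by push_cast; ring,
    show s + k + i + (t + (m + i : ℕ) + 1) = s + t + k + (m + i : ℕ) + i + 1 by ring,
    show s + k + i + (t + i) = s + t + k + 2 * i by ring,
    show s + t + (m + i : ℕ) - 1 = s + t + m + i - 1 by push_cast; ring,
    show s + t + (m + i : ℕ) + i = s + t + m + 2 * i by push_cast; ring,
    show s + t + k + i - 1 = s + k + t + i - 1 by ring,
    show m + 1 + i = m + i + 1 by ring]
  generalize rise (s + t + (m + 1 : ℕ) + 2 * i - 1) (m + 1) = r4 at *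
  generalize rise (s + k + t + i - 1) i = r5 at *
  generalize rise (s + t + m + i - 1) i = r2 at *
  generalize rise (s + t + m + 2 * i - 1) m = r3 at *
  generalize Complex.Gamma (s + t + m + 2 * i) = G0 at *
  generalize Complex.Gamma (s + t + k + (m + i : ℕ) + i + 1) = G8 at *
  generalize Complex.Gamma (s + t + k + (m + i : ℕ) + i) = G7 at *
  generalize Complex.Gamma (s + t + 2 * (m + i : ℕ)) = G6 at *
  generalize Complex.Gamma (s + t + k + 2 * i) = G5 at *
  generalize Complex.Gamma (t + i) = G4 at *
  generalize Complex.Gamma (s + k + i) = G3 at *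
  generalize Complex.Gamma (t + (m + i : ℕ) + 1) = G9 at *
  generalize Complex.Gamma (t + (m + i : ℕ)) = G2 at *
  generalize Complex.Gamma (s + (m + i : ℕ)) = G1 at *
  generalize s + t + 2 * (m + i : ℕ) = Z at *
  generalize ((m + i).factorial : ℂ) = F1 at *
  generalize (m.factorial : ℂ) = F2 at *
  generalize ((m + 1).factorial : ℂ) = F3 at *
  generalize ((m + i + 1).factorial : ℂ) = F5 at *
  generalize (i.factorial : ℂ) = F4 at *
  field_simp
  linear_combination (fall k m * F5 * fall k (m + 1) * G9) * e2

theorem choose_eq_fall (z : ℂ) (j : ℕ) : Ring.choose z j = fall z j / j.factorial := by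
  induction j with
  | zero => simp [fall_zero]
  | succ j ih =>
    have h1 : ((j.factorial : ℕ) : ℂ) ≠ 0 := by exact_mod_cast j.factorial_ne_zero
    have h2 : (j : ℂ) + 1 ≠ 0 := by exact_mod_cast j.succ_ne_zero
    have hrec : Ring.choose z (j + 1) = Ring.choose z j * (z - j) / (j + 1) := by
      rw [Ring.choose_eq_smul, Ring.choose_eq_smul, descPochhammer_succ_right]
      simp [Nat.factorial_succ, Polynomial.smeval_mul, Polynomial.smeval_sub,
        Polynomial.smeval_natCast]
      field_simp
    rw [hrec, ih, fall_succ, Nat.factorial_succ]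
    push_cast
    field_simp

theorem binom_natCast (z : ℂ) (j : ℕ) : binom z j = fall z j / j.factorial := by
  simp [binom, choose_eq_fall]

/-- Only Γ(a+b+n), n = m + i + 1, and, when i = 0, Γ(a+b+k+1) can meet a pole. Their arguments have
real part above -1, so the pole can only be at 0, which `h0` and `h1` exclude. -/
theorem coeffU_eq_coeffV {a b : ℝ} {k : ℂ} (ha : -1 < a) (hb : -1 < b) (hk : -1 < b + k.re)
    (m i : ℕ) (h0 : a + b + (m + i + 1 : ℕ) ≠ 0) (h1 : (a : ℂ) + b + k + 1 ≠ 0) :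
    coeffU (m + i + 1) a b k (m + 1) = coeffV (m + i) (b + 1) (a + 1) k i := by
  have hs : 0 < ((b : ℂ) + 1).re := by simp; linarith
  have ht : 0 < ((a : ℂ) + 1).re := by simp; linarith
  have hsk : 0 < ((b : ℂ) + 1 + k).re := by simp; linarith
  have h0' : (b : ℂ) + 1 + (a + 1) + (m + i : ℕ) - 1 ≠ 0 := by
    rw [show (b : ℂ) + 1 + (a + 1) + (m + i : ℕ) - 1 = ((a + b + (m + i + 1 : ℕ) : ℝ) : ℂ) by
      push_cast; ring]
    exact_mod_cast h0
  have eU : coeffU (m + i + 1) a b k (m + 1) =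
      (((b : ℂ) + 1 + (a + 1) + k + i - 1 + i) *
        (Complex.Gamma ((b : ℂ) + 1 + (a + 1) + k + i - 1) /
          Complex.Gamma ((b : ℂ) + 1 + (a + 1) + (m + i : ℕ) - 1)) *
        (Complex.Gamma ((a : ℂ) + 1 + (m + i : ℕ) + 1) / Complex.Gamma ((a : ℂ) + 1 + i)) *
        (Complex.Gamma ((b : ℂ) + 1 + k + i) / Complex.Gamma ((b : ℂ) + 1 + (m + i : ℕ)))) /
      ((Complex.Gamma ((b : ℂ) + 1 + (a + 1) + k + (m + i : ℕ) + i + 1) /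
          Complex.Gamma ((b : ℂ) + 1 + (a + 1) + (m + i : ℕ) - 1 + i)) *
        (Complex.Gamma ((b : ℂ) + 1 + (a + 1) + k + (m + i : ℕ) + i) /
          Complex.Gamma ((b : ℂ) + 1 + (a + 1) + (m + i : ℕ) + i)) *
        (Complex.Gamma (i + 1) / Complex.Gamma ((m + i + 1 : ℕ) + 1))) := by
    unfold coeffU poch
    push_cast
    ring_nf
  have h1' : (b : ℂ) + 1 + (a + 1) + k - 1 ≠ 0 := by
    convert h1 using 1; ring
  rw [eU, coeffV]
  generalize (b : ℂ) + 1 = s at *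
  generalize (a : ℂ) + 1 = t at *
  have hst : 0 < (s + t).re := by rw [Complex.add_re]; exact add_pos hs ht
  have hstk : 0 < (s + t + k).re := by
    rw [show s + t + k = s + k + t by ring, Complex.add_re]; exact add_pos hsk ht
  have hG {x y : ℂ} (hx : 0 < x.re) (l : ℕ) (h : y = x + l) : Complex.Gamma y ≠ 0 :=
    Complex.Gamma_ne_zero_of_re_pos (re_pos_of_eq_add_nat hx l h)
  -- Unless m + i + l = 0, the shift by -1 is compensated and the real part is positive; the
  -- remaining case is `h0`. The same applies to `hy` and `h1`.
  have hx (l : ℕ) : s + t + (m + i : ℕ) - 1 + l ≠ 0 := by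
    rcases Nat.eq_zero_or_pos (m + i + l) with h | h
    · obtain rfl : l = 0 := by omega
      simpa using h0'
    · obtain ⟨r, hr⟩ : ∃ r, m + i + l = r + 1 := ⟨m + i + l - 1, by omega⟩
      refine ne_zero_of_re_pos (re_pos_of_eq_add_nat hst r ?_)
      have : ((m + i : ℕ) : ℂ) + l = r + 1 := by exact_mod_cast hr
      linear_combination this
  have hy (l : ℕ) : s + t + k + i - 1 + l ≠ 0 := by
    rcases Nat.eq_zero_or_pos (i + l) with h | h
    · obtain rfl : l = 0 := by omega
      obtain rfl : i = 0 := by omega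
      simpa using h1'
    · obtain ⟨r, hr⟩ : ∃ r, i + l = r + 1 := ⟨i + l - 1, by omega⟩
      refine ne_zero_of_re_pos (re_pos_of_eq_add_nat hstk r ?_)
      have : (i : ℂ) + l = r + 1 := by exact_mod_cast hr
      linear_combination this
  have e1 : Complex.Gamma (s + t + (m + i : ℕ) - 1 + i) =
      rise (s + t + (m + i : ℕ) - 1) i * Complex.Gamma (s + t + (m + i : ℕ) - 1) :=
    Gamma_add_nat fun l _ => hx l
  have e2 : Complex.Gamma (s + t + k + 2 * i) = rise (s + t + k + i - 1) i *
      (s + t + k + i - 1 + i) * Complex.Gamma (s + t + k + i - 1) := by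
    rw [← rise_succ, ← Gamma_add_nat fun l _ => hy l]
    push_cast
    ring_nf
  have n1 : Complex.Gamma (s + t + (m + i : ℕ) - 1) ≠ 0 := Complex.Gamma_ne_zero fun l hl =>
    hx l (by rw [hl, neg_add_cancel])
  have n2 : rise (s + t + (m + i : ℕ) - 1) i ≠ 0 := rise_ne_zero fun l _ => hx l
  have n3 : rise (s + t + k + i - 1) i ≠ 0 := rise_ne_zero fun l _ => hy l
  have f1 : (i.factorial : ℂ) ≠ 0 := by exact_mod_cast i.factorial_ne_zero
  have g1 : Complex.Gamma (t + i) ≠ 0 := hG ht i rfl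
  have g2 : Complex.Gamma (s + (m + i : ℕ)) ≠ 0 := hG hs (m + i) rfl
  have g3 : Complex.Gamma (s + t + k + (m + i : ℕ) + i + 1) ≠ 0 :=
    hG hstk (m + i + i + 1) (by push_cast; ring)
  have g4 : Complex.Gamma (s + t + k + (m + i : ℕ) + i) ≠ 0 :=
    hG hstk (m + i + i) (by push_cast; ring)
  rw [e1, e2, Complex.Gamma_nat_eq_factorial, Complex.Gamma_nat_eq_factorial]
  field_simp

theorem continuousAt_Gamma_of_re_pos {z : ℂ} (hz : 0 < z.re) :
    ContinuousAt Complex.Gamma z := by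
  refine (Complex.differentiableAt_Gamma z fun m h => ?_).continuousAt
  have := congrArg Complex.re h
  simp only [Complex.neg_re, Complex.natCast_re] at this
  have : (0 : ℝ) ≤ m := m.cast_nonneg
  linarith

theorem continuous_rise (n : ℕ) : Continuous fun x : ℂ => rise x n := by
  unfold rise
  fun_prop

theorem continuousAt_coeffV {s t k : ℂ} (hs : 0 < s.re) (hsk : 0 < (s + k).re) (ht : 0 < t.re)
    (n i : ℕ) : ContinuousAt (fun t => coeffV n s t k i) t := by
  have hst : 0 < (s + t).re := by rw [Complex.add_re]; exact add_pos hs ht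
  have hstk : 0 < (s + t + k).re := by
    rw [show s + t + k = s + k + t by ring, Complex.add_re]; exact add_pos hsk ht
  have hG {x : ℂ} {f : ℂ → ℂ} (hf : Continuous f) (hx : 0 < x.re) (l : ℕ) (h : f t = x + l) :
      ContinuousAt (fun t => Complex.Gamma (f t)) t :=
    ContinuousAt.comp' (continuousAt_Gamma_of_re_pos (re_pos_of_eq_add_nat hx l h))
      hf.continuousAt
  have hG0 {x y : ℂ} (hx : 0 < x.re) (l : ℕ) (h : y = x + l) : Complex.Gamma y ≠ 0 :=
    Complex.Gamma_ne_zero_of_re_pos (re_pos_of_eq_add_nat hx l h)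
  unfold coeffV
  refine ContinuousAt.div (ContinuousAt.mul (ContinuousAt.mul (ContinuousAt.mul
    continuousAt_const ?_) (ContinuousAt.mul ?_ ?_)) (ContinuousAt.div ?_ ?_ ?_))
    (ContinuousAt.mul ?_ ?_) (mul_ne_zero ?_ ?_)
  · exact (hG (by fun_prop) ht (n + 1) (by push_cast; ring)).div
      (hG (by fun_prop) ht i rfl) (hG0 ht i rfl)
  · exact ((continuous_rise i).comp' (by fun_prop)).continuousAt
  · exact hG (by fun_prop) hst (n + i) (by push_cast; ring)
  · exact hG (by fun_prop) hstk (2 * i) (by push_cast; ring)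
  · exact ((continuous_rise i).comp' (by fun_prop)).continuousAt
  · exact rise_sub_one_ne_zero hstk i
  · exact hG (by fun_prop) hstk (n + i + 1) (by push_cast; ring)
  · exact hG (by fun_prop) hstk (n + i) (by push_cast; ring)
  · exact hG0 hstk (n + i + 1) (by push_cast; ring)
  · exact hG0 hstk (n + i) (by push_cast; ring)

/-- The sum over `j` in terms of the pole-free coefficients. -/
theorem sum_betaL_one_sub_X_mul_sq_eq {s t k : ℂ} (hs : 0 < s.re) (hsk : 0 < (s + k).re)
    (ht : 0 < t.re) (n : ℕ) :
    k * ∑ i ∈ Finset.range (n + 1),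
      betaL (s + k) t ((1 - X) * (jacobi i s t * jacobi i s t)) / normSq i s t =
    ∑ m ∈ Finset.range (n + 1), binom k (m + 1 : ℕ) * binom k m * coeffV n s t k (n - m) := by
  rw [sum_betaL_one_sub_X_mul_sq hs hsk ht, betaL_jacobi_mul_jacobi_eq_sum hsk ht,
    ← Finset.sum_range_reflect, Finset.mul_sum]
  refine Finset.sum_congr rfl fun m hm => ?_
  obtain ⟨i, rfl⟩ := Nat.exists_eq_add_of_le (Nat.lt_succ_iff.1 (Finset.mem_range.1 hm))
  rw [show m + i + 1 - 1 - m = i by omega, show m + i - m = i by omega,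
    coeffV_eq hs hsk ht, binom_natCast, binom_natCast]
  ring

/-! ### Integrals over the cube and the one-point density. -/

theorem integrable_and_integral_cpow_mul_eval_mul_weight {a b : ℝ} {k : ℂ} (ha : -1 < a)
    (hk : -1 < b + k.re) (q : ℂ[X]) :
    Integrable (fun x : ℝ => (x : ℂ) ^ k * q.eval (x : ℂ) * (weight a b x : ℂ))
      (volume.restrict (Set.Icc (0 : ℝ) 1)) ∧
    ∫ x in Set.Icc (0 : ℝ) 1, (x : ℂ) ^ k * q.eval (x : ℂ) * (weight a b x : ℂ) =
      betaL (b + 1 + k) (a + 1) q := by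
  have ht : 0 < ((a : ℂ) + 1).re := by simp; linarith
  have hsk : 0 < ((b : ℂ) + 1 + k).re := by simp; linarith
  induction q using Polynomial.induction_on' with
  | add p q hp hq =>
    simp only [eval_add, mul_add, add_mul, map_add]
    exact ⟨hp.1.add hq.1, by rw [integral_add hp.1 hq.1, hp.2, hq.2]⟩
  | monomial m c =>
    have hm := re_add_nat_pos hsk m
    -- The powers combine only for 0 < x < 1; the endpoints are null, so values of powers at 0 do
    -- not matter.
    have e : Set.EqOn (fun x : ℝ => (x : ℂ) ^ k * (monomial m c).eval (x : ℂ) *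
        (weight a b x : ℂ)) (fun x : ℝ => c * ((x : ℂ) ^ ((b : ℂ) + 1 + k + m - 1) *
        (1 - (x : ℂ)) ^ ((a : ℂ) + 1 - 1))) (Set.Ioo 0 1) := by
      intro x hx
      have hx0 : (x : ℂ) ≠ 0 := by exact_mod_cast hx.1.ne'
      have h1 : (0 : ℝ) ≤ 1 - x := by linarith [hx.2]
      simp only [weight, eval_monomial]
      rw [Complex.ofReal_mul, Complex.ofReal_cpow hx.1.le, Complex.ofReal_cpow h1,
        show (b : ℂ) + 1 + k + m - 1 = k + m + b by ring, Complex.cpow_add _ _ hx0,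
        Complex.cpow_add _ _ hx0, Complex.cpow_natCast, add_sub_cancel_right]
      push_cast
      ring
    have hI := (intervalIntegrable_iff_integrableOn_Ioo_of_le zero_le_one).1
      (Complex.betaIntegral_convergent hm ht)
    constructor
    · change IntegrableOn _ _ _
      rw [integrableOn_Icc_iff_integrableOn_Ioo, integrableOn_congr_fun e measurableSet_Ioo]
      exact hI.const_mul c
    · rw [integral_Icc_eq_integral_Ioo, setIntegral_congr_fun measurableSet_Ioo e,
        integral_const_mul, ← integral_Ioc_eq_integral_Ioo,
        ← intervalIntegral.integral_of_le zero_le_one, betaL_monomial, beta,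
        ← Complex.betaIntegral_eq_Gamma_mul_div _ _ hm ht]
      rfl

theorem restrict_cube (n : ℕ) : (volume : Measure (Fin n → ℝ)).restrict (cube n) =
    Measure.pi fun _ => volume.restrict (Set.Icc (0 : ℝ) 1) := by
  rw [cube, volume_pi, Measure.restrict_pi_pi]

/-- Leibniz expansion of the joint density in terms of the Jacobi polynomials. -/
theorem prod_cpow_mul_jointWeight {a b : ℝ} {s t : ℂ} (hst : 0 < (s + t).re) {n : ℕ}
    (κ : Fin n → ℂ) (x : Fin n → ℝ) :
    (∏ l, (x l : ℂ) ^ κ l) * (jointWeight a b n x : ℂ) =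
      ∑ σ : Equiv.Perm (Fin n), ∑ τ : Equiv.Perm (Fin n),
        (((Equiv.Perm.sign σ : ℤ) : ℂ) * ((Equiv.Perm.sign τ : ℤ) : ℂ)) *
        ∏ l, ((x l : ℂ) ^ κ l * (jacobi (σ l) s t * jacobi (τ l) s t).eval (x l : ℂ) *
          (weight a b (x l) : ℂ)) := by
  -- Replacing the monomials in the Vandermonde matrix by monic polynomials of the same degrees does
  -- not change the determinant.
  have hdet : ∏ i, ∏ j ∈ Finset.Ioi i, ((x j : ℂ) - x i) =
      ∑ σ : Equiv.Perm (Fin n), ((Equiv.Perm.sign σ : ℤ) : ℂ) *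
        ∏ l, (jacobi (σ l) s t).eval (x l : ℂ) := by
    rw [← Matrix.det_vandermonde, Matrix.det_eval_matrixOfPolynomials_eq_det_vandermonde _
      (fun i : Fin n => jacobi i s t) (fun i => natDegree_jacobi hst i)
      (fun i => monic_jacobi hst i), ← Matrix.det_transpose, Matrix.det_apply']
    rfl
  have hsq : ((∏ i, ∏ j ∈ Finset.Ioi i, |x j - x i| ^ 2 : ℝ) : ℂ) =
      (∏ i, ∏ j ∈ Finset.Ioi i, ((x j : ℂ) - x i)) *
        ∏ i, ∏ j ∈ Finset.Ioi i, ((x j : ℂ) - x i) := by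
    simp only [sq_abs]
    push_cast
    simp only [← Finset.prod_mul_distrib, sq]
  rw [jointWeight, Complex.ofReal_mul, hsq, hdet, Finset.sum_mul_sum, Finset.mul_sum,
    Finset.mul_sum]
  refine Finset.sum_congr rfl fun σ _ => ?_
  rw [Finset.mul_sum, Finset.mul_sum]
  refine Finset.sum_congr rfl fun τ _ => ?_
  simp only [eval_mul, Finset.prod_mul_distrib, Complex.ofReal_prod]
  ring

theorem integrable_and_integral_prod_cpow_mul_jointWeight {a b : ℝ} (ha : -1 < a) (hb : -1 < b)
    {n : ℕ} {κ : Fin n → ℂ} (hκ : ∀ l, -1 < b + (κ l).re) :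
    Integrable (fun x : Fin n → ℝ => (∏ l, (x l : ℂ) ^ κ l) * (jointWeight a b n x : ℂ))
      (volume.restrict (cube n)) ∧
    ∫ x in cube n, (∏ l, (x l : ℂ) ^ κ l) * (jointWeight a b n x : ℂ) =
      ∑ σ : Equiv.Perm (Fin n), ∑ τ : Equiv.Perm (Fin n),
        (((Equiv.Perm.sign σ : ℤ) : ℂ) * ((Equiv.Perm.sign τ : ℤ) : ℂ)) *
        ∏ l, betaL (b + 1 + κ l) (a + 1)
          (jacobi (σ l) (b + 1) (a + 1) * jacobi (τ l) (b + 1) (a + 1)) := by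
  have hst : 0 < ((b : ℂ) + 1 + (a + 1)).re := by simp; linarith
  have h1 (σ τ : Equiv.Perm (Fin n)) (l : Fin n) :=
    integrable_and_integral_cpow_mul_eval_mul_weight ha (hκ l)
      (jacobi (σ l) (b + 1) (a + 1) * jacobi (τ l) (b + 1) (a + 1))
  have hI (σ τ : Equiv.Perm (Fin n)) := (Integrable.fintype_prod fun l => (h1 σ τ l).1).const_mul
    (((Equiv.Perm.sign σ : ℤ) : ℂ) * ((Equiv.Perm.sign τ : ℤ) : ℂ))
  simp only [prod_cpow_mul_jointWeight hst, restrict_cube]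
  refine ⟨integrable_finsetSum _ fun σ _ => integrable_finsetSum _ fun τ _ => hI σ τ, ?_⟩
  rw [integral_finsetSum _ fun σ _ => integrable_finsetSum _ fun τ _ => hI σ τ]
  refine Finset.sum_congr rfl fun σ _ => ?_
  rw [integral_finsetSum _ fun τ _ => hI σ τ]
  refine Finset.sum_congr rfl fun τ _ => ?_
  rw [integral_const_mul, integral_fintype_prod_eq_prod (𝕜 := ℂ) (fun l (y : ℝ) =>
    (y : ℂ) ^ κ l * (jacobi (σ l) (b + 1) (a + 1) * jacobi (τ l) (b + 1) (a + 1)).eval (y : ℂ) *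
          (weight a b y : ℂ))]
  exact congrArg _ (Finset.prod_congr rfl fun l _ => (h1 σ τ l).2)

/-- Distinct permutations differ in at least two places, hence at some l ≠ j, where the weight is
unshifted and orthogonality kills the product. Only σ = τ survives. -/
theorem sum_sign_prod_betaL {s t : ℂ} (hs : 0 < s.re) (ht : 0 < t.re) {n : ℕ} {κ : Fin n → ℂ}
    (j : Fin n) (hκ : ∀ l, l ≠ j → κ l = 0) :
    ∑ σ : Equiv.Perm (Fin n), ∑ τ : Equiv.Perm (Fin n),
        (((Equiv.Perm.sign σ : ℤ) : ℂ) * ((Equiv.Perm.sign τ : ℤ) : ℂ)) *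
        ∏ l, betaL (s + κ l) t (jacobi (σ l) s t * jacobi (τ l) s t) =
      (∏ l : Fin n, normSq l s t) * ∑ σ : Equiv.Perm (Fin n),
        betaL (s + κ j) t (jacobi (σ j) s t * jacobi (σ j) s t) / normSq (σ j) s t := by
  rw [Finset.mul_sum]
  refine Finset.sum_congr rfl fun σ _ => ?_
  rw [Finset.sum_eq_single σ]
  · have hsign : ((Equiv.Perm.sign σ : ℤ) : ℂ) * ((Equiv.Perm.sign σ : ℤ) : ℂ) = 1 := by
      rw [← Int.cast_mul, ← Units.val_mul, Int.units_mul_self]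
      simp
    have h : ∏ l ∈ Finset.univ.erase j,
        betaL (s + κ l) t (jacobi (σ l) s t * jacobi (σ l) s t) =
        ∏ l ∈ Finset.univ.erase j, normSq (σ l) s t := by
      refine Finset.prod_congr rfl fun l hl => ?_
      rw [hκ l (Finset.ne_of_mem_erase hl), add_zero, betaL_jacobi_mul_jacobi hs ht, if_pos rfl]
    have h0 := normSq_ne_zero hs ht (σ j)
    rw [hsign, one_mul, ← Equiv.prod_comp σ fun l => normSq l s t,
      ← Finset.mul_prod_erase _ _ (Finset.mem_univ j), h,
      ← Finset.mul_prod_erase _ (fun l => normSq (σ l) s t) (Finset.mem_univ j)]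
    field_simp
  · intro τ _ hτ
    obtain ⟨l, hlj, hl⟩ : ∃ l, l ≠ j ∧ σ l ≠ τ l := by
      by_contra! H
      refine hτ (Equiv.ext fun l => ?_)
      by_cases hl : l = j
      · subst hl
        by_contra hne
        obtain ⟨r, hr⟩ := σ.surjective (τ l)
        have hrl : r ≠ l := fun e => hne (by rw [← hr, e])
        exact hrl (τ.injective (by rw [← H r hrl, hr]))
      · exact (H l hl).symm
    rw [Finset.prod_eq_zero (Finset.mem_univ l), mul_zero]
    rw [hκ l hlj, add_zero, betaL_jacobi_mul_jacobi hs ht,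
      if_neg fun e => hl (Fin.ext e)]
  · intro h
    exact absurd (Finset.mem_univ σ) h

theorem sum_sum_perm_apply {n : ℕ} (f : Fin n → ℂ) :
    ∑ j : Fin n, ∑ σ : Equiv.Perm (Fin n), f (σ j) = n.factorial * ∑ i, f i := by
  rw [Finset.sum_comm, Finset.sum_congr rfl fun σ _ => Equiv.sum_comp σ f, Finset.sum_const,
    Finset.card_univ, Fintype.card_perm, Fintype.card_fin, nsmul_eq_mul]

theorem integrableOn_jointWeight {a b : ℝ} (ha : -1 < a) (hb : -1 < b) (n : ℕ) :
    IntegrableOn (jointWeight a b n) (cube n) := by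
  have h := (integrable_and_integral_prod_cpow_mul_jointWeight ha hb (n := n) (κ := 0)
    (fun _ => by simpa using hb)).1
  simp only [Pi.zero_apply, Complex.cpow_zero, Finset.prod_const_one, one_mul] at h
  exact h.re

theorem normConst_eq {a b : ℝ} (ha : -1 < a) (hb : -1 < b) {n : ℕ} (hn : 1 ≤ n) :
    (normConst a b n : ℂ) = n.factorial * ∏ l : Fin n, normSq l (b + 1) (a + 1) := by
  have hs : 0 < ((b : ℂ) + 1).re := by simp; linarith
  have ht : 0 < ((a : ℂ) + 1).re := by simp; linarith
  have h := (integrable_and_integral_prod_cpow_mul_jointWeight ha hb (n := n) (κ := 0)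
    (fun _ => by simpa using hb)).2
  rw [sum_sign_prod_betaL hs ht (κ := 0) ⟨0, hn⟩ fun _ _ => rfl] at h
  simp only [Pi.zero_apply, Complex.cpow_zero, Finset.prod_const_one, one_mul, add_zero,
    betaL_jacobi_mul_jacobi hs ht, if_true, div_self (normSq_ne_zero hs ht _), Finset.sum_const,
    Finset.card_univ, Fintype.card_perm, Fintype.card_fin, nsmul_eq_mul, mul_one] at h
  rw [normConst, ← integral_complex_ofReal, h, mul_comm]

theorem normConst_pos {a b : ℝ} (ha : -1 < a) (hb : -1 < b) {n : ℕ} (hn : 1 ≤ n) :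
    0 < normConst a b n := by
  have hs : 0 < ((b : ℂ) + 1).re := by simp; linarith
  have ht : 0 < ((a : ℂ) + 1).re := by simp; linarith
  have h0 : (normConst a b n : ℂ) ≠ 0 := by
    rw [normConst_eq ha hb hn]
    exact mul_ne_zero (by exact_mod_cast n.factorial_ne_zero)
      (Finset.prod_ne_zero_iff.2 fun l _ => normSq_ne_zero hs ht l)
  refine lt_of_le_of_ne (setIntegral_nonneg
    (MeasurableSet.univ_pi fun _ => measurableSet_Icc) fun x hx => ?_)
    fun h => h0 (by rw [← h, Complex.ofReal_zero])
  have hx' (l : Fin n) : x l ∈ Set.Icc (0 : ℝ) 1 := hx l (Set.mem_univ l)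
  refine mul_nonneg (Finset.prod_nonneg fun l _ => mul_nonneg (Real.rpow_nonneg (hx' l).1 _)
    (Real.rpow_nonneg (sub_nonneg.2 (hx' l).2) _)) ?_
  exact Finset.prod_nonneg fun i _ => Finset.prod_nonneg fun j _ => by positivity

theorem momentIntegrand_eq_sum (a b : ℝ) (k : ℂ) (n : ℕ) (x : Fin n → ℝ) :
    momentIntegrand a b k n x =
      ∑ j, (∏ l, (x l : ℂ) ^ (Pi.single j k : Fin n → ℂ) l) * (jointWeight a b n x : ℂ) := by
  rw [momentIntegrand, Finset.sum_mul]
  refine Finset.sum_congr rfl fun j _ => ?_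
  rw [Fintype.prod_eq_single j fun l hl => by rw [Pi.single_eq_of_ne hl, Complex.cpow_zero],
    Pi.single_eq_same]

theorem re_single_bound {b : ℝ} {k : ℂ} (hb : -1 < b) (hk : -1 < b + k.re) {n : ℕ}
    (j l : Fin n) : -1 < b + ((Pi.single j k : Fin n → ℂ) l).re := by
  by_cases h : l = j
  · subst h
    rwa [Pi.single_eq_same]
  · rw [Pi.single_eq_of_ne h]
    simpa using hb

theorem integrableOn_momentIntegrand {a b : ℝ} {k : ℂ} (ha : -1 < a) (hb : -1 < b)
    (hk : -1 < b + k.re) (n : ℕ) : IntegrableOn (momentIntegrand a b k n) (cube n) := by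
  rw [funext (momentIntegrand_eq_sum a b k n)]
  exact integrable_finsetSum _ fun j _ => (integrable_and_integral_prod_cpow_mul_jointWeight ha hb
    (re_single_bound hb hk j)).1

/-- The moments in terms of the one-point density of the ensemble. -/
theorem moment_eq {a b : ℝ} {k : ℂ} (ha : -1 < a) (hb : -1 < b) (hk : -1 < b + k.re) {n : ℕ}
    (hn : 1 ≤ n) :
    moment a b k n = ∑ i ∈ Finset.range n, betaL (b + 1 + k) (a + 1)
      (jacobi i (b + 1) (a + 1) * jacobi i (b + 1) (a + 1)) / normSq i (b + 1) (a + 1) := by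
  have hs : 0 < ((b : ℂ) + 1).re := by simp; linarith
  have ht : 0 < ((a : ℂ) + 1).re := by simp; linarith
  have h (j : Fin n) := integrable_and_integral_prod_cpow_mul_jointWeight ha hb
    (re_single_bound hb hk j)
  have hC : (normConst a b n : ℂ) ≠ 0 := by exact_mod_cast (normConst_pos ha hb hn).ne'
  rw [moment, one_div, inv_mul_eq_iff_eq_mul₀ hC, funext (momentIntegrand_eq_sum a b k n),
    integral_finsetSum _ fun j _ => (h j).1, Finset.sum_congr rfl fun j _ => (h j).2,
    Finset.sum_congr rfl fun j _ => sum_sign_prod_betaL hs ht j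
      fun l hl => by rw [Pi.single_eq_of_ne hl]]
  simp only [Pi.single_eq_same]
  rw [← Finset.mul_sum, sum_sum_perm_apply fun i : Fin n => betaL (b + 1 + k) (a + 1)
      (jacobi i (b + 1) (a + 1) * jacobi i (b + 1) (a + 1)) / normSq i (b + 1) (a + 1),
    normConst_eq ha hb hn, Finset.sum_range]
  ring

/-! ### Moment formulas and the limit at the exceptional parameters. -/

theorem momentDiff_eq {a b : ℝ} {k : ℂ} (ha : -1 < a) (hb : -1 < b) (hk : -1 < b + k.re)
    (hk0 : k ≠ 0) (n : ℕ) :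
    momentDiff a b k (n + 1) = 1 / k * ∑ m ∈ Finset.range (n + 1),
      binom k (m + 1 : ℕ) * binom k m * coeffV n (b + 1) (a + 1) k (n - m) := by
  have hs : 0 < ((b : ℂ) + 1).re := by simp; linarith
  have ht : 0 < ((a : ℂ) + 1).re := by simp; linarith
  have hsk : 0 < ((b : ℂ) + 1 + k).re := by simp; linarith
  have hk1 : -1 < b + (k + 1).re := by simp; linarith
  rw [← sum_betaL_one_sub_X_mul_sq_eq hs hsk ht, one_div, inv_mul_cancel_left₀ hk0, momentDiff,
    moment_eq ha hb hk n.succ_pos, moment_eq ha hb hk1 n.succ_pos, ← Finset.sum_sub_distrib]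
  refine Finset.sum_congr rfl fun i _ => ?_
  rw [← sub_div, sub_mul, one_mul, map_sub, betaL_X_mul, add_assoc ((b : ℂ) + 1)]

theorem moment_one {a b : ℝ} (ha : -1 < a) (hb : -1 < b) {n : ℕ} (hn : 1 ≤ n) :
    moment a b 1 n = n * (b + n) / (a + b + 2 * n) := by
  have hs : 0 < ((b : ℂ) + 1).re := by simp; linarith
  have ht : 0 < ((a : ℂ) + 1).re := by simp; linarith
  obtain ⟨n, rfl⟩ := Nat.exists_eq_add_of_le' hn
  have h := sum_betaL_X_mul_jacobi_sq hs ht n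
  simp only [betaL_X_mul] at h
  rw [moment_eq ha hb (by simp; linarith) hn, h]
  push_cast
  ring_nf

/-- The difference formula, for the summands with pole-free Gamma factors. -/
theorem sum_coeffU_eq {a b : ℝ} {k : ℂ} (ha : -1 < a) (hb : -1 < b) (hk : -1 < b + k.re)
    (n : ℕ) (h0 : a + b + (n + 1 : ℕ) ≠ 0) (h1 : (a : ℂ) + b + k + 1 ≠ 0) :
    ∑ j ∈ Finset.range (n + 1 + 1), binom k j * binom k (j - 1) * coeffU (n + 1) a b k j =
    ∑ m ∈ Finset.range (n + 1),
      binom k (m + 1 : ℕ) * binom k m * coeffV n (b + 1) (a + 1) k (n - m) := by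
  rw [Finset.sum_range_succ']
  -- The j = 0 term drops out whatever value `coeffU` takes there, so the index shifts to m = j - 1.
  have hz : binom k (((0 : ℕ) : ℤ) - 1) = 0 := by simp [binom]
  rw [hz, mul_zero, zero_mul, add_zero]
  refine Finset.sum_congr rfl fun m hm => ?_
  obtain ⟨i, rfl⟩ := Nat.exists_eq_add_of_le (Nat.lt_succ_iff.1 (Finset.mem_range.1 hm))
  rw [coeffU_eq_coeffV ha hb hk m i h0 h1, Nat.add_sub_cancel_left, Nat.cast_succ,
    add_sub_cancel_right]

theorem momentDiff_eq_sum_coeffU {a b : ℝ} {k : ℂ} (ha : -1 < a) (hb : -1 < b)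
    (hk : -1 < b + k.re) (hk0 : k ≠ 0) {n : ℕ} (hn : 1 ≤ n) (h0 : a + b + n ≠ 0)
    (h1 : (a : ℂ) + b + k + 1 ≠ 0) :
    momentDiff a b k n = 1 / k * ∑ j ∈ Finset.range (n + 1),
      binom k j * binom k (j - 1) * coeffU n a b k j := by
  obtain ⟨n, rfl⟩ := Nat.exists_eq_add_of_le' hn
  rw [momentDiff_eq ha hb hk hk0, sum_coeffU_eq ha hb hk n h0 h1]

theorem tendsto_sum_coeffU {a b : ℝ} {k : ℂ} (ha : -1 < a) (hb : -1 < b)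
    (hk : -1 < b + k.re) (hk0 : k ≠ 0) {n : ℕ} (hn : 1 ≤ n) :
    Tendsto (fun a' : ℝ => 1 / k * ∑ j ∈ Finset.range (n + 1),
      binom k j * binom k (j - 1) * coeffU n a' b k j) (𝓝[≠] a) (𝓝 (momentDiff a b k n)) := by
  have hs : 0 < ((b : ℂ) + 1).re := by simp; linarith
  have ht : 0 < ((a : ℂ) + 1).re := by simp; linarith
  have hsk : 0 < ((b : ℂ) + 1 + k).re := by simp; linarith
  obtain ⟨n, rfl⟩ := Nat.exists_eq_add_of_le' hn
  -- At most two real values of a' are exceptional, and a punctured neighbourhood avoids each, even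
  -- one equal to a. For complex k it is enough to avoid the zero of the real part of a' + b + k +
  -- 1.
  have hev (c : ℝ) : ∀ᶠ a' in 𝓝[≠] a, a' ≠ c := by
    by_cases hc : a = c
    · subst hc
      exact self_mem_nhdsWithin
    · exact eventually_nhdsWithin_of_eventually_nhds (eventually_ne_nhds hc)
  have e : (fun a' : ℝ => 1 / k * ∑ m ∈ Finset.range (n + 1),
      binom k (m + 1 : ℕ) * binom k m * coeffV n (b + 1) (a' + 1) k (n - m)) =ᶠ[𝓝[≠] a]
      fun a' : ℝ => 1 / k * ∑ j ∈ Finset.range (n + 1 + 1),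
        binom k j * binom k (j - 1) * coeffU (n + 1) a' b k j := by
    filter_upwards [eventually_nhdsWithin_of_eventually_nhds (eventually_gt_nhds ha),
      hev (-(b + (n + 1 : ℕ))), hev (-(b + k.re + 1))] with a' h h0 h1
    rw [sum_coeffU_eq h hb hk n (fun hz => h0 (by linear_combination hz)) fun hz => h1 ?_]
    have := congrArg Complex.re hz
    simp at this
    linear_combination this
  refine Tendsto.congr' e ?_
  rw [momentDiff_eq ha hb hk hk0]
  refine tendsto_nhdsWithin_of_tendsto_nhds (Tendsto.const_mul _ (tendsto_finsetSum _
    fun m _ => Tendsto.const_mul _ ?_))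
  exact Tendsto.comp (continuousAt_coeffV hs hsk ht n (n - m))
    (Continuous.tendsto (by fun_prop) a : Tendsto (fun a' : ℝ => (a' : ℂ) + 1) _ _)

theorem binom_natCast_eq_zero {k j : ℕ} (h : k < j) : binom k j = 0 := by
  simp [binom, Ring.choose_natCast, Nat.choose_eq_zero_of_lt h]

theorem sum_range_min (n k : ℕ) (f : ℕ → ℂ) :
    ∑ j ∈ Finset.range (n + 1), binom k j * binom k (j - 1) * f j =
      ∑ j ∈ Finset.range (min n k + 1), binom k j * binom k (j - 1) * f j := by
  refine (Finset.sum_subset (Finset.range_mono (by omega)) fun j hj hj' => ?_).symm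
  rw [Finset.mem_range] at hj hj'
  rw [binom_natCast_eq_zero (by omega), zero_mul, zero_mul]

theorem sum_Icc_min (n k : ℕ) (f : ℕ → ℂ) :
    ∑ j ∈ Finset.Icc 1 (min k n), binom k j * binom k (j - 1) * f j =
      ∑ j ∈ Finset.range (n + 1), binom k j * binom k (j - 1) * f j := by
  rw [sum_range_min, min_comm]
  refine Finset.sum_subset (fun j hj => ?_) fun j hj hj' => ?_
  · rw [Finset.mem_Icc] at hj
    exact Finset.mem_range.2 (by omega)
  · rw [Finset.mem_range] at hj
    rw [Finset.mem_Icc] at hj'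
    obtain rfl : j = 0 := by omega
    simp [binom]

theorem moment_eq_sub_sum_momentDiff (a b : ℝ) (n : ℕ) {k : ℕ} (hk : 1 ≤ k) :
    moment a b k n = moment a b 1 n - ∑ j ∈ Finset.Icc 1 (k - 1), momentDiff a b j n := by
  induction k, hk using Nat.le_induction with
  | base => simp
  | succ k hk ih =>
    obtain ⟨k, rfl⟩ := Nat.exists_eq_add_of_le' hk
    rw [Nat.add_sub_cancel] at ih ⊢
    rw [Finset.sum_Icc_succ_top (by omega), ← sub_sub, ← ih, momentDiff]
    push_cast
    ring

theorem natCast_pole_free {a b : ℝ} (ha : -1 < a) (hb : -1 < b) {k : ℕ} (hk : 1 ≤ k) :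
    (a : ℂ) + b + (k : ℂ) + 1 ≠ 0 := by
  have h1 : (1 : ℝ) ≤ k := by exact_mod_cast hk
  refine ne_zero_of_re_pos ?_
  simp
  linarith

theorem neg_one_lt_add_natCast_re {b : ℝ} (hb : -1 < b) (k : ℕ) : -1 < b + (k : ℂ).re := by
  have h1 : (0 : ℝ) ≤ k := k.cast_nonneg
  rw [Complex.natCast_re]
  linarith

end JUE

end

theorem mainTheorem3 (n : ℕ) (hn : 1 ≤ n) (a b : ℝ) (ha : -1 < a) (hb : -1 < b) :
    -- the ensemble and its moments are given by convergent integrals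
    (IntegrableOn (JUE.jointWeight a b n) (JUE.cube n) ∧ 0 < JUE.normConst a b n ∧
      ∀ k : ℂ, -1 < b + k.re → IntegrableOn (JUE.momentIntegrand a b k n) (JUE.cube n)) ∧
    -- differences of moments, complex `k`, no Gamma factor evaluated at a pole
    (∀ k : ℂ, -1 < b + k.re → k ≠ 0 → a + b + n ≠ 0 → (a : ℂ) + b + k + 1 ≠ 0 →
      JUE.momentDiff a b k n =
        1 / k * ∑ j ∈ Finset.range (n + 1),
          JUE.binom k j * JUE.binom k (j - 1) * JUE.coeffU n a b k j) ∧
    -- the same for every complex `k`, the right-hand side being read as a limit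
    (∀ k : ℂ, -1 < b + k.re → k ≠ 0 →
      Tendsto (fun a' : ℝ => 1 / k * ∑ j ∈ Finset.range (n + 1),
          JUE.binom k j * JUE.binom k (j - 1) * JUE.coeffU n a' b k j)
        (𝓝[≠] a) (𝓝 (JUE.momentDiff a b k n))) ∧
    -- differences of moments, positive integer `k`
    (∀ k : ℕ, 1 ≤ k → a + b + n ≠ 0 →
      JUE.momentDiff a b k n =
        1 / k * ∑ j ∈ Finset.range (min n k + 1),
          JUE.binom k j * JUE.binom k (j - 1) * JUE.coeffU n a b k j) ∧
    -- the first moment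
    JUE.moment a b 1 n = n * (b + n) / (a + b + 2 * n) ∧
    -- the positive integer moments
    (∀ k : ℕ, 1 ≤ k → a + b + n ≠ 0 →
      JUE.moment a b k n = JUE.moment a b 1 n -
        ∑ j ∈ Finset.Icc 1 (k - 1), 1 / (j : ℂ) * ∑ i ∈ Finset.Icc 1 (min j n),
          JUE.binom j i * JUE.binom j (i - 1) * JUE.coeffU n a b j i) ∧
    -- the same without exception, the right-hand side being read as a limit
    (∀ k : ℕ, 1 ≤ k →
      Tendsto (fun a' : ℝ => JUE.moment a b 1 n -
          ∑ j ∈ Finset.Icc 1 (k - 1), 1 / (j : ℂ) * ∑ i ∈ Finset.Icc 1 (min j n),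
            JUE.binom j i * JUE.binom j (i - 1) * JUE.coeffU n a' b j i)
        (𝓝[≠] a) (𝓝 (JUE.moment a b k n))) := by
  have hnat {k : ℕ} (hk : 1 ≤ k) : (k : ℂ) ≠ 0 := by exact_mod_cast (by omega : k ≠ 0)
  have hb' := JUE.neg_one_lt_add_natCast_re hb
  refine ⟨⟨JUE.integrableOn_jointWeight ha hb n, JUE.normConst_pos ha hb hn,
    fun k hk => JUE.integrableOn_momentIntegrand ha hb hk n⟩,
    fun k hk hk0 h0 h1 => JUE.momentDiff_eq_sum_coeffU ha hb hk hk0 hn h0 h1,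
    fun k hk hk0 => JUE.tendsto_sum_coeffU ha hb hk hk0 hn, fun k hk h0 => ?_,
    JUE.moment_one ha hb hn, fun k hk h0 => ?_, fun k hk => ?_⟩
  · rw [JUE.momentDiff_eq_sum_coeffU ha hb (hb' k) (hnat hk) hn h0
      (JUE.natCast_pole_free ha hb hk), JUE.sum_range_min]
  · rw [JUE.moment_eq_sub_sum_momentDiff a b n hk]
    refine congrArg _ (Finset.sum_congr rfl fun j hj => ?_)
    have hj1 := (Finset.mem_Icc.1 hj).1
    rw [JUE.momentDiff_eq_sum_coeffU ha hb (hb' j) (hnat hj1) hn h0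
      (JUE.natCast_pole_free ha hb hj1), JUE.sum_Icc_min]
  · rw [JUE.moment_eq_sub_sum_momentDiff a b n hk]
    refine tendsto_const_nhds.sub (tendsto_finsetSum _ fun j hj => ?_)
    have hj1 := (Finset.mem_Icc.1 hj).1
    simp only [JUE.sum_Icc_min]
    exact JUE.tendsto_sum_coeffU ha hb (hb' j) (hnat hj1) hn
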